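/- Let $(X,d)$ be a geodesic metric space that is hyperbolic, i.e. there is $\delta$ such that the Gromov products satisfy $(x|z)_w\ge\min\{(x|y)_w,(y|z)_w\}-\delta$ for all $x,y,z,w\in X$. Let $C>0$ and let $\mathcal Y=(Y_i)_{i\in I}$ be a family of $C$-quasiconvex subsets of $X$: for all $x,y\in Y_i$, every point of every geodesic of $X$ from $x$ to $y$ is at distance at most $C$ from a point of $Y_i$. (1) Let $X^{el}_{\mathcal Y}$ be the electrification of $X$ along $\mathcal Y$: the space obtained from $X\sqcup\bigsqcup_{i\in I}Y_i\times[0,1]$ by identifying $(y,0)$ with $y\in Y_i\subset X$ and by identifying, for each $i$, all points of $Y_i\times\{1\}$ to one cone point $v_i$, with the path metric (infimum of lengths of paths) of its quotient metric, i.e. of the largest pseudometric that is at most $d$ on $X$ and at most $|s-t|$ on each segment $\{y\}\times[0,1]$. Then $X^{el}_{\mathcal Y}$ is hyperbolic. (2) Assume moreover that $\mathcal Y$ is mutually cobounded: there are $D$ and, for each $i$ with $Y_i\neq\emptyset$, a map $\pi_i:X\to Y_i$ which is a nearest point projection up to an error of at most $1$ (that is, $d(x,\pi_i(x))\le d(x,Y_i)+1$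 for all $x\in X$; exact nearest point projections are a particular case), such that any two points of $\pi_i(Y_j)$ are at distance less than $D$ whenever $i\ne j$. Let $X^{h}_{\mathcal Y}$ be the horoballification of $X$ over $\mathcal Y$: the space obtained from $X\sqcup\bigsqcup_{i\in I}Y_i\times[1,\infty)$ by identifying $(y,1)$ with $y\in Y_i\subset X$, with the largest pseudometric that is at most $d$ on $X$, at most $|s-t|$ on each ray $\{y\}\times[1,\infty)$, and at most $2^{-k}d$ on each horosphere $Y_i\times\{k\}$, for every integer $k\ge1$. Then $X^{h}_{\mathcal Y}$ is hyperbolic. In (1) and (2), hyperbolicity means that all distances are finite and that the above inequality between Gromov products holds for some constant. -/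

import Mathlib

open scoped ENNReal

/-! ### Geodesics, geodesic spaces, quasiconvex subsets, hyperbolicity -/

/-- `γ` restricted to `[0, dist x y]` is a geodesic from `x` to `y`. -/
structure IsGeodesicFromTo {X : Type*} [MetricSpace X] (γ : ℝ → X) (x y : X) : Prop where
  source : γ 0 = x
  target : γ (dist x y) = y
  isometric : ∀ s ∈ Set.Icc (0 : ℝ) (dist x y), ∀ t ∈ Set.Icc (0 : ℝ) (dist x y),
    dist (γ s) (γ t) = |s - t|

/-- Any two points are joined by a geodesic. -/
def IsGeodesicSpace (X : Type*) [MetricSpace X] : Prop :=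
  ∀ x y : X, ∃ γ : ℝ → X, IsGeodesicFromTo γ x y

/-- `Q` is `C`-quasiconvex: every point of every geodesic with endpoints in `Q` is at distance
at most `C` from a point of `Q`. -/
def IsQuasiconvexSubset {X : Type*} [MetricSpace X] (C : ℝ) (Q : Set X) : Prop :=
  ∀ x ∈ Q, ∀ y ∈ Q, ∀ γ : ℝ → X, IsGeodesicFromTo γ x y →
    ∀ t ∈ Set.Icc (0 : ℝ) (dist x y), ∃ q ∈ Q, dist (γ t) q ≤ C

/-- The Gromov product `(x, y)_w` for a distance `d`. -/
noncomputable def gromovProduct {Z : Type*} (d : Z → Z → ℝ≥0∞) (x y w : Z) : ℝ :=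
  ((d x w).toReal + (d y w).toReal - (d x y).toReal) / 2

/-- Gromov hyperbolicity of a set `Z` with a distance `d`: all distances are finite and, for some
`δ`, `(x, z)_w ≥ min ((x, y)_w, (y, z)_w) - δ` for all `x, y, z, w`. -/
def IsGromovHyperbolic {Z : Type*} (d : Z → Z → ℝ≥0∞) : Prop :=
  (∀ x y : Z, d x y ≠ ⊤) ∧
    ∃ δ : ℝ, ∀ x y z w : Z,
      min (gromovProduct d x y w) (gromovProduct d y z w) - δ ≤ gromovProduct d x z w

/-- `π` is a nearest point projection onto `Q` up to an error of at most `1`. (Exact nearest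
points need not exist in `Q`; an exact nearest point projection is a particular case.) -/
def IsNearestPointProjection {X : Type*} [MetricSpace X] (Q : Set X) (π : X → X) : Prop :=
  ∀ x : X, π x ∈ Q ∧ ∀ q ∈ Q, dist x (π x) ≤ dist x q + 1

/-- The family `Y` is mutually cobounded: for some `D`, the projection to any `Y i` of any other
member of the family has all its mutual distances less than `D`. -/
def IsMutuallyCobounded {X : Type*} [MetricSpace X] {I : Type*} (Y : I → Set X) : Prop :=
  ∃ D : ℝ, ∃ π : I → X → X, (∀ i, (Y i).Nonempty → IsNearestPointProjection (Y i) (π i)) ∧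
    ∀ i j, i ≠ j → (Y i).Nonempty →
      ∀ a ∈ Y j, ∀ b ∈ Y j, dist (π i a) (π i b) < D

/-! ### The largest pseudometric dominated by prescribed bounds, and path metrics -/

/-- `M a b r` prescribes the bound `r` for the distance of `a` and `b`. `ChainLength M a b l` says
that `a` and `b` are joined by a finite chain of such prescribed steps (in either direction) of
total length `l`. -/
inductive ChainLength {Z : Type*} (M : Z → Z → ℝ≥0∞ → Prop) : Z → Z → ℝ≥0∞ → Prop
  | refl (a : Z) : ChainLength M a a 0
  | forward {a b c : Z} {l r : ℝ≥0∞} :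
      ChainLength M a b l → M b c r → ChainLength M a c (l + r)
  | backward {a b c : Z} {l r : ℝ≥0∞} :
      ChainLength M a b l → M c b r → ChainLength M a c (l + r)

/-- The infimum of the lengths of chains. -/
noncomputable def chainEDist {Z : Type*} (M : Z → Z → ℝ≥0∞ → Prop) (a b : Z) : ℝ≥0∞ :=
  ⨅ (l : ℝ≥0∞) (_ : ChainLength M a b l), l

theorem ChainLength.append {Z : Type*} {M : Z → Z → ℝ≥0∞ → Prop} {a b c : Z} {l m : ℝ≥0∞}
    (h : ChainLength M a b l) (h2 : ChainLength M b c m) : ChainLength M a c (l + m) := by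
  induction h2 with
  | refl => simpa using h
  | forward _ hM ih => rw [← add_assoc]; exact ih.forward hM
  | backward _ hM ih => rw [← add_assoc]; exact ih.backward hM

theorem ChainLength.reverse {Z : Type*} {M : Z → Z → ℝ≥0∞ → Prop} {a b : Z} {l : ℝ≥0∞}
    (h : ChainLength M a b l) : ChainLength M b a l := by
  induction h with
  | refl => exact ChainLength.refl _
  | forward _ hM ih =>
    rw [add_comm]
    have := ((ChainLength.refl _).backward hM).append ih
    rwa [zero_add] at this
  | backward _ hM ih =>
    rw [add_comm]
    have := ((ChainLength.refl _).forward hM).append ih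
    rwa [zero_add] at this

/-- `chainEDist M` as an (extended) pseudometric. -/
@[reducible]
noncomputable def chainPseudoEMetric {Z : Type*} (M : Z → Z → ℝ≥0∞ → Prop) :
    PseudoEMetricSpace Z where
  edist := chainEDist M
  edist_self a := le_antisymm (iInf₂_le 0 (ChainLength.refl a)) bot_le
  edist_comm a b := le_antisymm
    (le_iInf₂ fun l h => iInf₂_le l h.reverse) (le_iInf₂ fun l h => iInf₂_le l h.reverse)
  edist_triangle a b c := by
    unfold chainEDist
    simp only [ENNReal.iInf_add, ENNReal.add_iInf]
    exact le_iInf₂ fun l h => le_iInf₂ fun m h2 => iInf₂_le _ (h2.append h)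

/-- `chainEDist M` obeys the prescribed bounds ... -/
theorem chainEDist_le {Z : Type*} {M : Z → Z → ℝ≥0∞ → Prop} {a b : Z} {r : ℝ≥0∞}
    (h : M a b r) : chainEDist M a b ≤ r := by
  have := (ChainLength.refl a).forward h
  rw [zero_add] at this
  exact iInf₂_le r this

/-- ... and it is the largest pseudometric that does. -/
theorem le_chainEDist {Z : Type*} [PseudoEMetricSpace Z] {M : Z → Z → ℝ≥0∞ → Prop}
    (hM : ∀ a b r, M a b r → edist a b ≤ r) (a b : Z) : edist a b ≤ chainEDist M a b := by
  refine le_iInf₂ fun l h => ?_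
  induction h with
  | refl => simp
  | forward _ h ih => exact (edist_triangle _ _ _).trans (add_le_add ih (hM _ _ _ h))
  | backward _ h ih =>
    refine (edist_triangle _ _ _).trans (add_le_add ih ?_)
    rw [edist_comm]
    exact hM _ _ _ h

/-- The path metric of a pseudometric space: the infimum of the lengths of continuous paths. -/
noncomputable def pathEDist {Z : Type*} [PseudoEMetricSpace Z] (a b : Z) : ℝ≥0∞ :=
  ⨅ γ : Path a b, eVariationOn γ Set.univ

/-! ### Electrification -/

section Electrification

/-- The identifications `(y, 0) ∼ y` and `(y, 1) ∼ (z, 1)` (for `y, z` in the same `Y i`) on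
`X ⊔ ⨆ i, Y i × [0, 1]`. -/
inductive ElectrificationGlue {X I : Type*} (Y : I → Set X) :
    (X ⊕ (Σ i, Y i × unitInterval)) → (X ⊕ (Σ i, Y i × unitInterval)) → Prop
  | base (i : I) (y : Y i) : ElectrificationGlue Y (Sum.inr ⟨i, (y, 0)⟩) (Sum.inl (y : X))
  | apex (i : I) (y z : Y i) :
      ElectrificationGlue Y (Sum.inr ⟨i, (y, 1)⟩) (Sum.inr ⟨i, (z, 1)⟩)

/-- The coned-off space. -/
def Electrification {X I : Type*} (Y : I → Set X) : Type _ := Quot (ElectrificationGlue Y)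

namespace Electrification

/-- The inclusion of `X`. -/
def ofBase {X I : Type*} (Y : I → Set X) (x : X) : Electrification Y := Quot.mk _ (Sum.inl x)

/-- The class of `(y, t) ∈ Y i × [0, 1]`. -/
def cone {X I : Type*} (Y : I → Set X) (i : I) (y : Y i) (t : unitInterval) :
    Electrification Y := Quot.mk _ (Sum.inr ⟨i, (y, t)⟩)

/-- The bounds that define the quotient metric: that of `X`, and those of the segments
`{y} × [0, 1]`. (The metric of `Y i × {0}` is the restriction of that of `X`.) -/
inductive Bound {X I : Type*} [MetricSpace X] (Y : I → Set X) :
    Electrification Y → Electrification Y → ℝ≥0∞ → Prop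
  | base (x z : X) : Bound Y (ofBase Y x) (ofBase Y z) (edist x z)
  | segment (i : I) (y : Y i) (s t : unitInterval) :
      Bound Y (cone Y i y s) (cone Y i y t) (edist s t)

/-- The quotient metric. -/
noncomputable instance {X I : Type*} [MetricSpace X] (Y : I → Set X) :
    PseudoEMetricSpace (Electrification Y) := chainPseudoEMetric (Bound Y)

/-- The electric metric: the path metric of the quotient metric. -/
noncomputable def electricEDist {X I : Type*} [MetricSpace X] (Y : I → Set X) :
    Electrification Y → Electrification Y → ℝ≥0∞ := pathEDist

end Electrification

end Electrification

/-! ### Horoballification -/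

section Horoballification

/-- The identification `(y, 1) ∼ y` of the boundary horosphere of the horoball `Y i × [1, ∞)` over
`Y i` with `Y i ⊆ X`, on `X ⊔ ⨆ i, Y i × [1, ∞)`. -/
inductive HoroballificationGlue {X I : Type*} (Y : I → Set X) :
    (X ⊕ (Σ i, Y i × Set.Ici (1 : ℝ))) → (X ⊕ (Σ i, Y i × Set.Ici (1 : ℝ))) → Prop
  | base (i : I) (y : Y i) :
      HoroballificationGlue Y (Sum.inr ⟨i, (y, ⟨1, Set.self_mem_Ici⟩)⟩) (Sum.inl (y : X))

/-- The space `X` with a horoball `Y i × [1, ∞)` glued along each `Y i`. -/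
def Horoballification {X I : Type*} (Y : I → Set X) : Type _ := Quot (HoroballificationGlue Y)

namespace Horoballification

/-- The inclusion of `X`. -/
def ofBase {X I : Type*} (Y : I → Set X) (x : X) : Horoballification Y := Quot.mk _ (Sum.inl x)

/-- The class of `(y, t) ∈ Y i × [1, ∞)`. -/
def horoball {X I : Type*} (Y : I → Set X) (i : I) (y : Y i) (t : Set.Ici (1 : ℝ)) :
    Horoballification Y := Quot.mk _ (Sum.inr ⟨i, (y, t)⟩)

/-- The bounds that define the metric: that of `X`, those of the vertical rays `{y} × [1, ∞)`, and
the metric `2⁻ᵏ d` on each horosphere `Y i × {k}` of integral height `k ≥ 1`. -/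
inductive Bound {X I : Type*} [MetricSpace X] (Y : I → Set X) :
    Horoballification Y → Horoballification Y → ℝ≥0∞ → Prop
  | base (x z : X) : Bound Y (ofBase Y x) (ofBase Y z) (edist x z)
  | vertical (i : I) (y : Y i) (s t : Set.Ici (1 : ℝ)) :
      Bound Y (horoball Y i y s) (horoball Y i y t) (edist s t)
  | horizontal (i : I) (y z : Y i) (k : ℕ) (hk : 1 ≤ k) :
      Bound Y (horoball Y i y ⟨(k : ℝ), Set.mem_Ici.mpr (Nat.one_le_cast.mpr hk)⟩)
        (horoball Y i z ⟨(k : ℝ), Set.mem_Ici.mpr (Nat.one_le_cast.mpr hk)⟩) (edist (y : X) (z : X) / 2 ^ k)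

/-- The metric of the horoballification: the infimum of the lengths of finite concatenations of
steps in `X`, vertical steps, and steps of length `2⁻ᵏ d` in horospheres of height `k`. A step
inside a horosphere counts with its length even if no continuous curve of `Y i` realizes it, as
is the case for horizontal edges of combinatorial horoballs. -/
noncomputable def horoballEDist {X I : Type*} [MetricSpace X] (Y : I → Set X) :
    Horoballification Y → Horoballification Y → ℝ≥0∞ := chainEDist (Bound Y)

end Horoballification

end Horoballification

/-! # Hyperbolicity of electrifications and horoballifications

Hyperbolicity is used throughout as the four-point condition (`FourPoint`), which only involves
sums of distances; a point `p` is on a geodesic from `x` to `y` when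
`dist x p + dist p y = dist x y`.

Let `ρ` be the restriction to `X` of the electric or the horoball distance. The proof rests on a
criterion for guessing geodesics, `IsGuess.defect_le`: if each pair `x, y` of points of `X` is given
a set of points such that these sets form thin triangles, and the sets of the pairs in a
common `Y i` are right up to a bounded error, then all points of these sets satisfy
`ρ x p + ρ p y ≤ ρ x y + K` for a constant `K`. The reason is that the largest defect `t` can be
improved to `t - 1`: a point `p` of defect close to `t` is not close to the guess from `x` to a
point slightly below the level `ρ x p - t / 2` of an almost shortest path, nor to the guess from a
point slightly above that level to `y`, and the guess in between is short.

For the electrification, whose path metric is the chain metric since `X` is geodesic, the guesses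
are the geodesics of `X`. Of the three pairs of opposite sides of a quadrilateral in `X`, two
cross (`exists_crossing`), which gives the four-point condition for `ρ`; and all
points are at distance at most `1` from `X`.

For the horoballification, the guesses are the points of the geodesics of `X` that are not deep in
any `Y i` (`IsShallow`). Coboundedness implies that a geodesic between points whose projections to
`Y i` are far apart is shallow near these projections (`IsProjectionSystem.exists_isShallow`).
So shortest paths between such points pass through the projections
(`IsShallowCompatible.add_add_le`). If two geodesics of `X` cross at shallow points, one argues as
for the electrification; if they cross deep in `Y i`, the four points can be replaced by their
projections to `Y i`, and one is left with the four-point condition in one horoball. There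
the distance of two points of heights `s, t` over points of `X` at distance `d` is
`2 * logb 2 (2 ^ s + 2 ^ t + d / 4) - s - t` up to a bounded error, and the logarithm of a
quasi-ultrametric satisfies the four-point condition. Points of horoballs, which can be
arbitrarily far from `X`, are added to the four-point condition one at a time, by projecting the
other three points to their horoball (`IsHyperbolicAttachment.fourPoint_of_ι`). -/

/-! ### Real-valued pseudometrics and the four-point condition -/

/-- A real-valued pseudometric, as a bare function. -/
structure IsPseudoDist {Z : Type*} (ρ : Z → Z → ℝ) : Prop where
  self : ∀ x, ρ x x = 0
  symm : ∀ x y, ρ x y = ρ y x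
  triangle : ∀ x y z, ρ x z ≤ ρ x y + ρ y z

theorem IsPseudoDist.nonneg {Z : Type*} {ρ : Z → Z → ℝ} (hρ : IsPseudoDist ρ) (x y : Z) :
    0 ≤ ρ x y := by
  linarith [hρ.self x, hρ.symm x y, hρ.triangle x y x]

/-- Gromov's four-point condition: of the three ways to sum the distances of four points in two
pairs, none exceeds the larger of the other two by more than `δ`. -/
def FourPoint {Z : Type*} (ρ : Z → Z → ℝ) (δ : ℝ) : Prop :=
  ∀ x y z w : Z, ρ x y + ρ z w ≤ max (ρ x z + ρ y w) (ρ x w + ρ y z) + δ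

theorem FourPoint.cases {Z : Type*} {ρ : Z → Z → ℝ} {δ : ℝ} (h : FourPoint ρ δ) (x y z w : Z) :
    ρ x y + ρ z w ≤ ρ x z + ρ y w + δ ∨ ρ x y + ρ z w ≤ ρ x w + ρ y z + δ := by
  have := h x y z w
  rcases max_cases (ρ x z + ρ y w) (ρ x w + ρ y z) with ⟨h1, _⟩ | ⟨h1, _⟩ <;> rw [h1] at this
  · exact .inl this
  · exact .inr this

theorem isGromovHyperbolic_of_fourPoint {Z : Type*} {e : Z → Z → ℝ≥0∞}
    (hfin : ∀ x y, e x y ≠ ⊤) (hsymm : ∀ x y, e x y = e y x) {δ : ℝ}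
    (h : FourPoint (fun x y => (e x y).toReal) δ) : IsGromovHyperbolic e := by
  refine ⟨hfin, δ / 2, fun x y z w => ?_⟩
  unfold gromovProduct
  have h1 := h.cases x z y w
  simp only [hsymm z y] at h1
  rcases h1 with h1 | h1
  · have := min_le_left (((e x w).toReal + (e y w).toReal - (e x y).toReal) / 2)
      (((e y w).toReal + (e z w).toReal - (e y z).toReal) / 2)
    linarith
  · have := min_le_right (((e x w).toReal + (e y w).toReal - (e x y).toReal) / 2)
      (((e y w).toReal + (e z w).toReal - (e y z).toReal) / 2)
    linarith

theorem IsGromovHyperbolic.fourPoint {X : Type*} [MetricSpace X]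
    (h : IsGromovHyperbolic (edist : X → X → ℝ≥0∞)) :
    ∃ δ : ℝ, 0 ≤ δ ∧ FourPoint (dist : X → X → ℝ) δ := by
  obtain ⟨-, δ, hδ⟩ := h
  refine ⟨2 * |δ|, by positivity, fun x y z w => ?_⟩
  have h1 := hδ x z y w
  unfold gromovProduct at h1
  simp only [← dist_edist] at h1
  have h2 := le_abs_self δ
  have h3 := le_max_left (dist x z + dist y w) (dist x w + dist y z)
  have h4 := le_max_right (dist x z + dist y w) (dist x w + dist y z)
  rw [dist_comm z y] at h1
  rcases min_cases ((dist x w + dist z w - dist x z) / 2)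
    ((dist z w + dist y w - dist y z) / 2) with ⟨h5, _⟩ | ⟨h5, _⟩ <;> rw [h5] at h1 <;> linarith

/-! ### Guessing geodesics -/

/-- A system of guesses for the geodesics of `ρ`: `η x y p` says that `p` lies on the guess from
`x` to `y`. Guesses form `h`-thin triangles, and `E` is a set of edges along which they are right up
to `K`, such that every pair of points can be joined by almost geodesic paths which cross every
intermediate level by an edge. The guesses need not be connected. -/
structure IsGuess {X : Type*} (ρ : X → X → ℝ) (η : X → X → X → Prop) (E : X → X → Prop)
    (h K : ℝ) : Prop where
  symm : ∀ {x y p}, η x y p → η y x p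
  thin : ∀ {x y p}, η x y p → ∀ z, ∃ q, (η x z q ∨ η z y q) ∧ ρ p q ≤ h
  edge : ∀ {x y p}, E x y → η x y p → ρ x p + ρ p y ≤ ρ x y + K
  small : ∀ {x y p}, ρ x y ≤ 1 → η x y p → ρ x p + ρ p y ≤ K
  step : ∀ x y r, 0 ≤ r → r ≤ ρ x y → ∃ z z', E z z' ∧ ρ x z ≤ r ∧
    ρ x z + ρ z z' + ρ z' y ≤ ρ x y + 1 / 2 ∧ r + ρ z' y ≤ ρ x y + 1 / 2

section Guess

variable {X : Type*} {ρ : X → X → ℝ} {η : X → X → X → Prop} {E : X → X → Prop} {h K : ℝ}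

/-- Guesses between points at bounded distance have bounded size. -/
theorem IsGuess.bounded (hρ : IsPseudoDist ρ) (H : IsGuess ρ η E h K) (n : ℕ) :
    ∃ K' : ℝ, ∀ x y p, ρ x y ≤ 1 + n / 2 → η x y p → ρ x p + ρ p y ≤ K' := by
  induction n with
  | zero => exact ⟨K, fun x y p hxy => H.small (by simpa using hxy)⟩
  | succ n ih =>
    obtain ⟨K', hK'⟩ := ih
    refine ⟨2 * (1 + (n + 1) / 2 + 1 / 2 + |K| + |K'| + 2 * h) + (1 + (n + 1) / 2),
      fun x y p hxy hp => ?_⟩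
    push_cast at hxy
    have a1 := le_abs_self K
    have a2 := le_abs_self K'
    have a3 := abs_nonneg K
    have a4 := abs_nonneg K'
    have hn : (0 : ℝ) ≤ n := n.cast_nonneg
    have hpp : 0 ≤ h := by
      obtain ⟨q, -, hq⟩ := H.thin hp x
      exact (hρ.nonneg _ _).trans hq
    by_cases h1 : ρ x y ≤ 1
    · have := H.small h1 hp
      linarith
    suffices ρ x p ≤ 1 + (n + 1) / 2 + 1 / 2 + |K| + |K'| + 2 * h by
      linarith [hρ.triangle p x y, hρ.symm p x]
    obtain ⟨z, z', hE, hz1, hz2, hz3⟩ := H.step x y 1 zero_le_one (not_le.mp h1).le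
    have b1 := hρ.nonneg z z'
    have b2 := hρ.nonneg z' y
    obtain ⟨q, hq | hq, hpq⟩ := H.thin hp z
    · linarith [H.small hz1 hq, hρ.triangle x q p, hρ.symm p q, hρ.nonneg q z]
    obtain ⟨q', hq' | hq', hqq⟩ := H.thin hq z'
    · linarith [H.edge hE hq', hρ.triangle x q p, hρ.symm p q, hρ.triangle x q' q, hρ.symm q q',
        hρ.triangle x z q', hρ.nonneg q' z']
    · linarith [hK' _ _ _ (by linarith) hq', hρ.triangle x q p, hρ.symm p q, hρ.triangle x q' q,
        hρ.symm q q', hρ.triangle x z' q', hρ.triangle x z z', hρ.nonneg q' y]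

/-- If the defect `ρ x p + ρ p y - ρ x y` of the guesses between points at distance at most `N` is
bounded by some `t`, then it is bounded by `t - 1`, down to a threshold that does not depend
on `N`. A guess point `p` of defect more than `t - 1` cannot be close to the guess from `x` to a
point `z` at distance less than `ρ x p - t / 2 - h` of `x`, since it would have defect
more than `t` there. So it is close to the guess between two points around that level. -/
theorem IsGuess.improve (hρ : IsPseudoDist ρ) (H : IsGuess ρ η E h K) {K' N t : ℝ}
    (hK' : ∀ x y p, ρ x y ≤ 4 * h + 4 → η x y p → ρ x p + ρ p y ≤ K')
    (ht : ∀ x y p, ρ x y ≤ N → η x y p → ρ x p + ρ p y ≤ ρ x y + t) :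
    ∀ x y p, ρ x y ≤ N → η x y p →
      ρ x p + ρ p y ≤ ρ x y + max (t - 1) (2 * |K| + |K'| + 8 * h + 2) := by
  intro x y p hxy hp
  by_contra! hcon
  have c1 := le_max_left (t - 1) (2 * |K| + |K'| + 8 * h + 2)
  have c2 := le_max_right (t - 1) (2 * |K| + |K'| + 8 * h + 2)
  have a1 := le_abs_self K
  have a2 := le_abs_self K'
  have a3 := abs_nonneg K
  have a4 := abs_nonneg K'
  have hh : 0 ≤ h := by
    obtain ⟨q, -, hq⟩ := H.thin hp x
    exact (hρ.nonneg _ _).trans hq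
  have htp := ht x y p hxy hp
  have t1 := hρ.triangle x y p
  have t2 := hρ.triangle p x y
  have s1 := hρ.symm p y
  have s2 := hρ.symm p x
  have n1 := hρ.nonneg x y
  -- No guess starting at one of the endpoints and ending below the critical level comes near `p`.
  have far : ∀ x y, ρ x y ≤ N → ρ x p + ρ p y ≤ ρ x y + t →
      ρ x y + (2 * |K| + |K'| + 8 * h + 2) < ρ x p + ρ p y → ∀ z q k, 0 ≤ k → k ≤ 3 * h →
      ρ x z ≤ max (ρ x p - t / 2 - k - 1) 0 → η x z q → ρ p q ≤ k → False := by
    intro x y hxy htp hcon z q k hk hk3 hz hq hpq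
    have t1 := hρ.triangle x q p
    have s3 := hρ.symm p q
    have t2 := hρ.triangle p x y
    have s2 := hρ.symm p x
    have t5 := hρ.triangle x y p
    have s5 := hρ.symm p y
    rcases max_cases (ρ x p - t / 2 - k - 1) 0 with ⟨h5, _⟩ | ⟨h5, _⟩ <;> rw [h5] at hz
    · have := ht x z q (by linarith) hq
      linarith [hρ.triangle x z p, hρ.triangle z q p, hρ.symm q z]
    · have := H.small (by linarith) hq
      linarith [hρ.nonneg q z]
  obtain ⟨z, z', hE, hz1, hz2, hz3⟩ := H.step x y (max (ρ x p - t / 2 - h - 1) 0)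
    (le_max_right _ _) (max_le (by linarith) n1)
  have m1 := le_max_left (ρ x p - t / 2 - h - 1) 0
  have m2 := le_max_left (ρ y p - t / 2 - 3 * h - 1) 0
  obtain ⟨q, hq | hq, hpq⟩ := H.thin hp z
  · exact far x y hxy htp (by linarith) z q h hh (by linarith) hz1 hq hpq
  obtain ⟨q2, hq2 | hq2, hqq2⟩ := H.thin hq z'
  · linarith [H.edge hE hq2, hρ.triangle x z p, hρ.triangle z q2 p, hρ.triangle q2 q p,
      hρ.symm q q2, hρ.symm p q, hρ.triangle p q y, hρ.triangle q q2 y, hρ.triangle q2 z' y]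
  have hpq2 : ρ p q2 ≤ 2 * h := by linarith [hρ.triangle p q q2]
  have sy := hρ.symm x y
  have far' := far y x (by linarith) (by linarith) (by linarith)
  by_cases hz' : ρ y z' ≤ max (ρ y p - t / 2 - 3 * h - 1) 0
  · exact far' z' q2 (3 * h) (by linarith) le_rfl hz' (H.symm hq2) (by linarith)
  obtain ⟨z3, z2, hE', hy1, hy2, hy3⟩ := H.step y z' _ (le_max_right _ _) (not_le.mp hz').le
  obtain ⟨q3, hq3 | hq3, hqq3⟩ := H.thin hq2 z3
  swap
  · exact far' z3 q3 (3 * h) (by linarith) le_rfl hy1 (H.symm hq3)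
      (by linarith [hρ.triangle p q2 q3])
  obtain ⟨q4, hq4 | hq4, hqq4⟩ := H.thin hq3 z2
  all_goals
    have hpq4 : ρ p q4 ≤ 4 * h := by
      linarith [hρ.triangle p q2 q3, hρ.triangle p q3 q4]
    have u1 := hρ.symm z' y
    have u2 := hρ.symm p q4
    have u3 := hρ.triangle x z z'
    have u4 := hρ.triangle x z' p
    have u5 := hρ.symm z2 z'
    have u6 := hρ.triangle p q4 y
    have u7 := hρ.symm y z3
    have u8 := hρ.symm z3 z2
  · have := hK' z' z2 q4 (by linarith) hq4
    linarith [hρ.triangle z' q4 p, hρ.triangle q4 z2 y, hρ.triangle z2 z3 y, hρ.nonneg z2 z']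
  · have := H.edge hE' (H.symm hq4)
    linarith [hρ.triangle z' z2 p, hρ.triangle z2 q4 p, hρ.triangle q4 z3 y, hρ.symm z2 q4,
      hρ.symm z3 q4]

/-- **Guessing geodesics**: all points of the guesses are on geodesics up to a bounded error. -/
theorem IsGuess.defect_le (hρ : IsPseudoDist ρ) (H : IsGuess ρ η E h K) :
    ∃ K' : ℝ, ∀ x y p, η x y p → ρ x p + ρ p y ≤ ρ x y + K' := by
  obtain ⟨m, hm⟩ := exists_nat_ge (2 * (4 * h + 4))
  obtain ⟨K', hK'⟩ := H.bounded hρ m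
  refine ⟨2 * |K| + |K'| + 8 * h + 2, fun x y p hp => ?_⟩
  obtain ⟨n, hn⟩ := exists_nat_ge (2 * ρ x y)
  obtain ⟨t, ht⟩ := H.bounded hρ n
  have iter : ∀ k : ℕ, ∀ x y p, ρ x y ≤ 1 + n / 2 → η x y p →
      ρ x p + ρ p y ≤ ρ x y + max (t - k) (2 * |K| + |K'| + 8 * h + 2) := by
    intro k
    induction k with
    | zero =>
      intro x y p hxy hp
      have := le_max_left (t - (0 : ℕ)) (2 * |K| + |K'| + 8 * h + 2)
      push_cast at this ⊢
      linarith [ht x y p hxy hp, hρ.nonneg x y]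
    | succ k ih =>
      intro x y p hxy hp
      refine (H.improve hρ (fun x y p h1 => hK' x y p (by linarith)) ih x y p hxy hp).trans ?_
      refine add_le_add le_rfl (max_le ?_ (le_max_right _ _))
      push_cast
      rcases max_cases (t - k) (2 * |K| + |K'| + 8 * h + 2) with ⟨h5, _⟩ | ⟨h5, _⟩ <;> rw [h5]
      · exact le_max_of_le_left (by linarith)
      · exact le_max_of_le_right (by linarith)
  obtain ⟨k, hk⟩ := exists_nat_ge (t - (2 * |K| + |K'| + 8 * h + 2))
  have := iter k x y p (by linarith) hp
  rwa [max_eq_right (by linarith)] at this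

end Guess

/-! ### Geodesics in a hyperbolic space

A point `p` lies on a geodesic from `x` to `y` if `dist x p + dist p y = dist x y`; the
parametrization of the geodesic plays no role. -/

section Hyperbolic

variable {X : Type*} [MetricSpace X]

theorem IsGeodesicSpace.exists_dist_eq (hX : IsGeodesicSpace X) (x y : X) {r : ℝ} (h0 : 0 ≤ r)
    (hr : r ≤ dist x y) : ∃ m, dist x m = r ∧ dist m y = dist x y - r := by
  obtain ⟨γ, hs, ht, hi⟩ := hX x y
  refine ⟨γ r, ?_, ?_⟩
  · have := hi 0 ⟨le_rfl, dist_nonneg⟩ r ⟨h0, hr⟩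
    rwa [hs, zero_sub, abs_neg, abs_of_nonneg h0] at this
  · have := hi r ⟨h0, hr⟩ (dist x y) ⟨dist_nonneg, le_rfl⟩
    rwa [ht, abs_sub_comm, abs_of_nonneg (by linarith)] at this

variable {δ : ℝ} (hδ : 0 ≤ δ) (hX : IsGeodesicSpace X) (hd : FourPoint (dist : X → X → ℝ) δ)

include hδ hX hd in
/-- A point that lies on a geodesic up to an error is close to a point on a geodesic. -/
theorem exists_between_dist_le {x z p : X} {k : ℝ} (hk : 0 ≤ k)
    (hp : dist x p + dist p z ≤ dist x z + k) :
    ∃ q, dist x q + dist q z = dist x z ∧ dist p q ≤ k + δ := by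
  by_cases h : dist x p ≤ dist x z
  · obtain ⟨m, h1, h2⟩ := hX.exists_dist_eq x z dist_nonneg h
    refine ⟨m, by linarith, ?_⟩
    have := dist_comm p x
    have := dist_comm m x
    rcases hd.cases p m x z with h | h <;> linarith
  · exact ⟨z, by simp, by linarith⟩

include hX hd in
/-- Geodesics with endpoints in a quasiconvex set stay close to it. -/
theorem IsQuasiconvexSubset.exists_dist_le {C : ℝ} {Q : Set X} (hQ : IsQuasiconvexSubset C Q)
    {a b p : X} (ha : a ∈ Q) (hb : b ∈ Q) (hp : dist a p + dist p b = dist a b) :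
    ∃ q ∈ Q, dist p q ≤ C + δ := by
  obtain ⟨γ, hγ⟩ := hX a b
  have hr : dist a p ∈ Set.Icc (0 : ℝ) (dist a b) :=
    ⟨dist_nonneg, by linarith [dist_nonneg (x := p) (y := b)]⟩
  obtain ⟨q, hq, hd'⟩ := hQ a ha b hb γ hγ _ hr
  have h1 := hγ.isometric 0 ⟨le_rfl, dist_nonneg⟩ _ hr
  have h2 := hγ.isometric _ hr (dist a b) ⟨dist_nonneg, le_rfl⟩
  rw [hγ.source, zero_sub, abs_neg, abs_of_nonneg dist_nonneg] at h1
  rw [hγ.target, abs_sub_comm, abs_of_nonneg (by linarith [hr.2])] at h2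
  refine ⟨q, hq, ?_⟩
  have e1 := dist_comm p a
  have e2 := dist_comm (γ (dist a p)) a
  have := dist_triangle p (γ (dist a p)) q
  rcases hd.cases p (γ (dist a p)) a b with h | h <;> linarith

include hδ hX hd in
/-- Geodesic triangles are thin. -/
theorem exists_between_of_triangle {x y p : X} (hp : dist x p + dist p y = dist x y) (z : X) :
    ∃ q, (dist x q + dist q z = dist x z ∨ dist z q + dist q y = dist z y) ∧
      dist p q ≤ 2 * δ := by
  have e1 := dist_comm p x
  have e2 := dist_comm z p
  have e3 := dist_comm z y
  have e4 := dist_comm z x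
  rcases hd.cases p z x y with h | h
  · obtain ⟨q, hq, hpq⟩ := exists_between_dist_le hδ hX hd (x := z) (z := y) (p := p) hδ
      (by linarith)
    exact ⟨q, .inr hq, by linarith⟩
  · obtain ⟨q, hq, hpq⟩ := exists_between_dist_le hδ hX hd (x := x) (z := z) (p := p) hδ
      (by linarith)
    exact ⟨q, .inl hq, by linarith⟩

include hδ hX hd in
/-- Of two pairs of opposite sides of a quadrilateral with vertices `x, y, z, w`, taken among
the pairs `xz, yw` and `xw, yz`, one crosses coarsely. -/
theorem exists_crossing (x y z w : X) :
    ∃ p, (dist x p + dist p z ≤ dist x z + 2 * δ ∧ dist y p + dist p w ≤ dist y w + 2 * δ) ∨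
      (dist x p + dist p w ≤ dist x w + 2 * δ ∧ dist y p + dist p z ≤ dist y z + 2 * δ) := by
  -- the point of a side `xz` opposite to `y` in the approximating tripod of `x, y, z`
  obtain ⟨p, h1, h2⟩ := hX.exists_dist_eq x z (r := (dist x y + dist x z - dist y z) / 2)
    (by linarith [dist_triangle y x z, dist_comm x y])
    (by linarith [dist_triangle x z y, dist_comm z y])
  have e1 := dist_comm p y
  have e2 := dist_comm x y
  have e3 := dist_comm p x
  have e4 := dist_comm y z
  have hy : dist y p ≤ (dist x y + dist y z - dist x z) / 2 + δ := by
    rcases hd.cases y p x z with h | h <;> linarith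
  refine ⟨p, ?_⟩
  have e5 := dist_comm w y
  have e6 := dist_comm w x
  rcases hd.cases p w x y with h | h
  · exact .inl ⟨by linarith, by linarith⟩
  · exact .inr ⟨by linarith, by linarith⟩

end Hyperbolic

/-! ### Chains -/

/-- Chain distances are bounded below by the variation of functions that obey the prescribed
bounds. -/
theorem abs_sub_le_chainEDist {Z : Type*} {M : Z → Z → ℝ≥0∞ → Prop} (f : Z → ℝ)
    (hf : ∀ a b r, M a b r → ENNReal.ofReal |f a - f b| ≤ r) (a b : Z)
    (hfin : chainEDist M a b ≠ ⊤) : |f a - f b| ≤ (chainEDist M a b).toReal := by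
  rw [← ENNReal.ofReal_le_iff_le_toReal hfin]
  clear hfin
  refine le_iInf₂ fun l hl => ?_
  induction hl with
  | refl => simp
  | @forward b c l r _ h ih =>
    refine le_trans ?_ (add_le_add ih (hf _ _ _ h))
    rw [← ENNReal.ofReal_add (abs_nonneg _) (abs_nonneg _)]
    exact ENNReal.ofReal_le_ofReal (abs_sub_le _ _ _)
  | @backward b c l r _ h ih =>
    refine le_trans ?_ (add_le_add ih (hf _ _ _ h))
    rw [← ENNReal.ofReal_add (abs_nonneg _) (abs_nonneg _), abs_sub_comm (f c)]
    exact ENNReal.ofReal_le_ofReal (abs_sub_le _ _ _)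

theorem isPseudoDist_chainEDist {Z : Type*} {M : Z → Z → ℝ≥0∞ → Prop}
    (hfin : ∀ a b, chainEDist M a b ≠ ⊤) :
    IsPseudoDist (fun a b => (chainEDist M a b).toReal) where
  self a := by
    rw [show chainEDist M a a = 0 from (chainPseudoEMetric M).edist_self a, ENNReal.toReal_zero]
  symm a b := congrArg _ ((chainPseudoEMetric M).edist_comm a b)
  triangle a b c := by
    rw [← ENNReal.toReal_add (hfin _ _) (hfin _ _)]
    exact ENNReal.toReal_mono (ENNReal.add_ne_top.mpr ⟨hfin _ _, hfin _ _⟩)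
      ((chainPseudoEMetric M).edist_triangle a b c)

theorem exists_chainLength_le {Z : Type*} {M : Z → Z → ℝ≥0∞ → Prop} {a b : Z}
    (hfin : chainEDist M a b ≠ ⊤) {ε : ℝ} (hε : 0 < ε) :
    ∃ l, l ≠ ⊤ ∧ ChainLength M a b l ∧ l.toReal ≤ (chainEDist M a b).toReal + ε := by
  have h : chainEDist M a b < chainEDist M a b + ENNReal.ofReal ε :=
    ENNReal.lt_add_right hfin (by simpa using hε)
  obtain ⟨l, hl⟩ := iInf_lt_iff.mp h
  obtain ⟨hc, hl⟩ := iInf_lt_iff.mp hl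
  have htop : chainEDist M a b + ENNReal.ofReal ε ≠ ⊤ :=
    ENNReal.add_ne_top.mpr ⟨hfin, ENNReal.ofReal_ne_top⟩
  refine ⟨l, ne_top_of_lt hl, hc, ?_⟩
  have := ENNReal.toReal_mono htop hl.le
  rwa [ENNReal.toReal_add hfin ENNReal.ofReal_ne_top, ENNReal.toReal_ofReal hε.le] at this

/-- A space `Z` glued from `X` and pieces `H i`, where the piece `H i` is attached to `X` along
`Y i`, with a chain distance whose steps are those of `X` or stay within one piece. The base
point `base u` of a point `u` of `H i` lies in `Y i`. -/
structure IsAttachment {X Z I : Type*} [MetricSpace X] (Y : I → Set X)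
    (M : Z → Z → ℝ≥0∞ → Prop) (ι : X → Z) (base : Z → X) (H : I → Set Z) : Prop where
  base_ι : ∀ x, base (ι x) = x
  ι_mem : ∀ {x i}, ι x ∈ H i → x ∈ Y i
  mem_ι : ∀ {x i}, x ∈ Y i → ι x ∈ H i
  base_mem : ∀ {u i}, u ∈ H i → base u ∈ Y i
  cover : ∀ u, u = ι (base u) ∨ ∃ i, u ∈ H i
  inter : ∀ {u i j}, u ∈ H i → u ∈ H j → i = j ∨ u = ι (base u)
  step : ∀ {a b r}, M a b r →
    (∃ x y, a = ι x ∧ b = ι y ∧ r = edist x y) ∨ ∃ i, a ∈ H i ∧ b ∈ H i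
  ι_step : ∀ x y, M (ι x) (ι y) (edist x y)
  ne_top : ∀ a b, chainEDist M a b ≠ ⊤

section Attachment

variable {X Z I : Type*} [MetricSpace X] {Y : I → Set X} {M : Z → Z → ℝ≥0∞ → Prop}
  {ι : X → Z} {base : Z → X} {H : I → Set Z}

/-- The chain distance, as a real number. -/
noncomputable def chainDist (M : Z → Z → ℝ≥0∞ → Prop) (a b : Z) : ℝ := (chainEDist M a b).toReal

namespace IsAttachment

variable (hA : IsAttachment Y M ι base H)
include hA

theorem isPseudoDist : IsPseudoDist (chainDist M) := isPseudoDist_chainEDist hA.ne_top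

theorem isPseudoDist_ι : IsPseudoDist (fun x y => chainDist M (ι x) (ι y)) :=
  ⟨fun _ => hA.isPseudoDist.self _, fun _ _ => hA.isPseudoDist.symm _ _,
    fun _ _ _ => hA.isPseudoDist.triangle _ _ _⟩

theorem chainDist_ι_le (x y : X) : chainDist M (ι x) (ι y) ≤ dist x y := by
  rw [dist_edist]
  exact ENNReal.toReal_mono (edist_ne_top _ _) (chainEDist_le (hA.ι_step x y))

/-- Induction on chains of finite length, with steps in `X` and steps in the pieces. -/
theorem chain_induction {a : Z} {P : Z → ℝ → Prop} (refl : P a 0)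
    (base_step : ∀ x y l, P (ι x) l → chainDist M a (ι x) ≤ l → P (ι y) (l + dist x y))
    (piece_step : ∀ i u v l r, u ∈ H i → v ∈ H i → P u l → chainDist M u v ≤ r →
      chainDist M a u ≤ l → P v (l + r))
    {b : Z} {l : ℝ≥0∞} (h : ChainLength M a b l) (hl : l ≠ ⊤) : P b l.toReal := by
  induction h with
  | refl => simpa using refl
  | @forward b c l r hc hM ih =>
    have hl' := ENNReal.add_ne_top.mp hl
    have hle : chainDist M a b ≤ l.toReal := ENNReal.toReal_mono hl'.1 (iInf₂_le l hc)
    rw [ENNReal.toReal_add hl'.1 hl'.2]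
    rcases hA.step hM with ⟨x, y, rfl, rfl, rfl⟩ | ⟨i, hb, hc⟩
    · rw [← dist_edist]
      exact base_step x y _ (ih hl'.1) hle
    · exact piece_step i _ _ _ _ hb hc (ih hl'.1)
        (ENNReal.toReal_mono hl'.2 (chainEDist_le hM)) hle
  | @backward b c l r hc hM ih =>
    have hl' := ENNReal.add_ne_top.mp hl
    have hle : chainDist M a b ≤ l.toReal := ENNReal.toReal_mono hl'.1 (iInf₂_le l hc)
    rw [ENNReal.toReal_add hl'.1 hl'.2]
    rcases hA.step hM with ⟨x, y, rfl, rfl, rfl⟩ | ⟨i, hb, hc⟩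
    · rw [← dist_edist, dist_comm]
      exact base_step y x _ (ih hl'.1) hle
    · refine piece_step i _ _ _ _ hc hb (ih hl'.1) ?_ hle
      rw [hA.isPseudoDist.symm]
      exact ENNReal.toReal_mono hl'.2 (chainEDist_le hM)

/-- A path from `v` into a piece that does not contain `v` enters through `X`. -/
theorem exists_entry {u v : Z} {i : I} (hu : u ∈ H i) (hv : v ∉ H i) :
    ∃ c ∈ Y i, chainDist M u (ι c) + chainDist M (ι c) v ≤ chainDist M u v + 1 := by
  have hρ := hA.isPseudoDist
  obtain ⟨l, hl, hc, hle⟩ := exists_chainLength_le (hA.ne_top v u) one_pos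
  have key : ∀ j, u ∈ H j → v ∈ H j ∨
      ∃ c ∈ Y j, chainDist M v (ι c) + chainDist M (ι c) u ≤ l.toReal := by
    refine hA.chain_induction (a := v)
      (P := fun w l => ∀ j, w ∈ H j → v ∈ H j ∨
        ∃ c ∈ Y j, chainDist M v (ι c) + chainDist M (ι c) w ≤ l)
      (fun j hj => .inl hj) (fun x y l _ hle j hj => ?_)
      (fun k w w' l r hw hw' IH hr hle j hj => ?_) hc hl
    · exact .inr ⟨y, hA.ι_mem hj, by
        linarith [hA.chainDist_ι_le x y, hρ.triangle v (ι x) (ι y), hρ.self (ι y)]⟩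
    · rcases hA.inter hw' hj with rfl | h
      · rcases IH k hw with h | ⟨c, hc, h⟩
        · exact .inl h
        · exact .inr ⟨c, hc, by linarith [hρ.triangle (ι c) w w']⟩
      · refine .inr ⟨base w', hA.base_mem hj, ?_⟩
        rw [← h]
        linarith [hρ.triangle v w w', hρ.self w']
  obtain ⟨c, hc, h⟩ := (key i hu).resolve_left hv
  refine ⟨c, hc, ?_⟩
  unfold chainDist at h ⊢
  have s1 := hρ.symm u v
  have s2 := hρ.symm u (ι c)
  have s3 := hρ.symm v (ι c)
  unfold chainDist at s1 s2 s3
  linarith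

/-- A path from a point of a piece to a point of `X` leaves the piece through `X`. -/
theorem exists_exit {u : Z} {i : I} (hu : u ∈ H i) (x : X) :
    ∃ c ∈ Y i, chainDist M u (ι c) + chainDist M (ι c) (ι x) ≤ chainDist M u (ι x) + 1 := by
  by_cases h : ι x ∈ H i
  · exact ⟨x, hA.ι_mem h, by linarith [hA.isPseudoDist.self (ι x)]⟩
  · exact hA.exists_entry hu h

/-- An almost shortest path between points of `X` crosses every level `r` either at a point of `X`
or in a piece. -/
theorem exists_step (hX : IsGeodesicSpace X) (x y : X) (r : ℝ) (hr0 : 0 ≤ r)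
    (hr : r ≤ chainDist M (ι x) (ι y)) :
    ∃ z z', (z = z' ∨ ∃ i, z ∈ Y i ∧ z' ∈ Y i) ∧ chainDist M (ι x) (ι z) ≤ r ∧
      chainDist M (ι x) (ι z) + chainDist M (ι z) (ι z') + chainDist M (ι z') (ι y)
        ≤ chainDist M (ι x) (ι y) + 1 / 2 ∧
      r + chainDist M (ι z') (ι y) ≤ chainDist M (ι x) (ι y) + 1 / 2 := by
  have hρ := hA.isPseudoDist
  obtain ⟨l, hl, hc, hle⟩ := exists_chainLength_le (hA.ne_top (ι x) (ι y)) one_half_pos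
  -- Either the level has been crossed, or the last visit to `X` was below it.
  let Crossed (w : Z) (l : ℝ) : Prop := ∃ z z', (z = z' ∨ ∃ i, z ∈ Y i ∧ z' ∈ Y i) ∧
    chainDist M (ι x) (ι z) ≤ r ∧
    chainDist M (ι x) (ι z) + chainDist M (ι z) (ι z') + chainDist M (ι z') w ≤ l ∧
    r + chainDist M (ι z') w ≤ l
  let P (w : Z) (l : ℝ) : Prop := Crossed w l ∨ ∃ z, (w = ι z ∨ ∃ i, w ∈ H i ∧ z ∈ Y i) ∧
    chainDist M (ι x) (ι z) ≤ r ∧ chainDist M (ι x) (ι z) + chainDist M (ι z) w ≤ l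
  have mono : ∀ w w' l s, Crossed w l → chainDist M w w' ≤ s → Crossed w' (l + s) := by
    rintro w w' l s ⟨z, z', h1, h2, h3, h4⟩ hs
    exact ⟨z, z', h1, h2, by linarith [hρ.triangle (ι z') w w'],
      by linarith [hρ.triangle (ι z') w w']⟩
  -- At a point of `X` which is reached above the level, the second alternative gives the first.
  have sharp : ∀ c l, P (ι c) l → chainDist M (ι x) (ι c) ≤ l → r ≤ l → Crossed (ι c) l := by
    rintro c l (h | ⟨z, h1, h2, h3⟩) hcl hrl
    · exact h
    · refine ⟨z, c, ?_, h2, ?_, ?_⟩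
      · rcases h1 with h1 | ⟨i, h1, h4⟩
        · left
          rw [← hA.base_ι z, ← h1, hA.base_ι]
        · exact .inr ⟨i, h4, hA.ι_mem h1⟩
      · linarith [hρ.self (ι c)]
      · linarith [hρ.self (ι c)]
  have key : P (ι y) l.toReal := by
    refine hA.chain_induction (a := ι x) (P := P) (.inr ⟨x, .inl rfl, ?_, ?_⟩)
      (fun c c' l h hle => ?_) (fun i w w' l s hw hw' h hs hle => ?_) hc hl
    · linarith [hρ.self (ι x)]
    · linarith [hρ.self (ι x)]
    · have hcc := hA.chainDist_ι_le c c'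
      by_cases hrl : r ≤ l
      · exact .inl (mono _ _ _ _ (sharp c l h hle hrl) hcc)
      by_cases hrl' : l + dist c c' ≤ r
      · exact .inr ⟨c', .inl rfl, by linarith [hρ.triangle (ι x) (ι c) (ι c')],
          by linarith [hρ.triangle (ι x) (ι c) (ι c'), hρ.self (ι c')]⟩
      · obtain ⟨m, h1, h2⟩ := hX.exists_dist_eq c c' (r := r - l) (by linarith) (by linarith)
        have := hA.chainDist_ι_le c m
        have := hA.chainDist_ι_le m c'
        have := hρ.triangle (ι x) (ι c) (ι m)
        exact .inl ⟨m, m, .inl rfl, by linarith, by linarith [hρ.self (ι m)], by linarith⟩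
    · rcases h with h | ⟨z, h1, h2, h3⟩
      · exact .inl (mono _ _ _ _ h hs)
      have hz : z ∈ Y i ∨ w = ι (base w) := by
        rcases h1 with h1 | ⟨j, h1, h4⟩
        · exact .inl (hA.ι_mem (h1 ▸ hw))
        · rcases hA.inter hw h1 with rfl | h5
          · exact .inl h4
          · exact .inr h5
      rcases hz with hz | hz
      · exact .inr ⟨z, .inr ⟨i, hw', hz⟩, h2, by linarith [hρ.triangle (ι z) w w']⟩
      · by_cases hrl : r ≤ l
        · refine .inl (mono w _ _ _ ?_ hs)
          rw [hz]
          refine sharp _ _ (.inr ⟨z, ?_, h2, by rwa [← hz]⟩) (by rwa [← hz]) hrl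
          rwa [← hz]
        · refine .inr ⟨base w, .inr ⟨i, hw', hA.base_mem hw⟩, ?_, ?_⟩ <;> rw [← hz] <;> linarith
  have hrl : r ≤ l.toReal := hr.trans (ENNReal.toReal_mono hl (iInf₂_le l hc))
  have hxl : chainDist M (ι x) (ι y) ≤ l.toReal := ENNReal.toReal_mono hl (iInf₂_le l hc)
  obtain ⟨z, z', h1, h2, h3, h4⟩ := sharp y _ key hxl hrl
  change _ ≤ chainDist M (ι x) (ι y) + 1 / 2 at hle
  exact ⟨z, z', h1, h2, by linarith, by linarith⟩

end IsAttachment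

end Attachment

/-! ### Path metrics -/

section PathMetric

variable {Z : Type*} [PseudoEMetricSpace Z]

theorem edist_le_pathEDist (a b : Z) : edist a b ≤ pathEDist a b := by
  refine le_iInf fun γ => ?_
  simpa using eVariationOn.edist_le γ (Set.mem_univ 0) (Set.mem_univ 1)

theorem eVariationOn_trans_le {a b c : Z} (γ : Path a b) (γ' : Path b c) :
    eVariationOn (γ.trans γ') Set.univ ≤ eVariationOn γ Set.univ + eVariationOn γ' Set.univ := by
  let m : unitInterval := ⟨1 / 2, by norm_num, by norm_num⟩
  rw [← Set.Iic_union_Ici (a := m), eVariationOn.union (x := m) _ isGreatest_Iic isLeast_Ici]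
  refine add_le_add ?_ ?_
  · let φ : unitInterval → unitInterval := fun t => Set.projIcc 0 1 zero_le_one (2 * (t : ℝ))
    have hφ : Monotone φ := fun s t hst => Set.monotone_projIcc _ (by
      have : (s : ℝ) ≤ t := hst
      linarith)
    rw [eVariationOn.congr (g := γ ∘ φ)]
    · exact eVariationOn.comp_le_of_monotoneOn _ _ (hφ.monotoneOn _) (by simp [Set.MapsTo])
    · intro t ht
      have ht : (t : ℝ) ≤ 1 / 2 := ht
      rw [Path.trans_apply, dif_pos ht]
      simp only [Function.comp, φ]
      rw [Set.projIcc_of_mem]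
  · let φ : unitInterval → unitInterval := fun t => Set.projIcc 0 1 zero_le_one (2 * (t : ℝ) - 1)
    have hφ : Monotone φ := fun s t hst => Set.monotone_projIcc _ (by
      have : (s : ℝ) ≤ t := hst
      linarith)
    rw [eVariationOn.congr (g := γ' ∘ φ)]
    · exact eVariationOn.comp_le_of_monotoneOn _ _ (hφ.monotoneOn _) (by simp [Set.MapsTo])
    · intro t ht
      have ht : 1 / 2 ≤ (t : ℝ) := ht
      rw [← Path.extend_extends' (γ.trans γ'), Path.extend_trans_of_half_le _ _ ht]
      rfl

theorem pathEDist_triangle (a b c : Z) : pathEDist a c ≤ pathEDist a b + pathEDist b c := by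
  unfold pathEDist
  simp only [ENNReal.iInf_add, ENNReal.add_iInf]
  exact le_iInf fun γ' => le_iInf fun γ =>
    (iInf_le _ (γ.trans γ')).trans (eVariationOn_trans_le γ γ')

theorem eVariationOn_id_unitInterval_le :
    eVariationOn (id : unitInterval → unitInterval) Set.univ ≤ 1 := by
  have h : MonotoneOn (Subtype.val : unitInterval → ℝ) Set.univ := fun _ _ _ _ h => h
  have := h.eVariationOn_eq (Set.mem_univ (0 : unitInterval)) (Set.mem_univ 1)
  have h2 : Set.univ ∩ Set.Icc (0 : unitInterval) 1 = Set.univ := by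
    ext t
    simp [unitInterval.le_one']
  rw [h2] at this
  exact (show eVariationOn (id : unitInterval → unitInterval) Set.univ
    = eVariationOn (Subtype.val : unitInterval → ℝ) Set.univ from rfl).trans_le
      (this.trans_le (by simp))

/-- A `1`-Lipschitz curve on `[0, c]` is a path of length at most `c`. -/
theorem pathEDist_le_of_lipschitz {a b : Z} (f : ℝ → Z) {c : ℝ} (hc : 0 ≤ c) (h0 : f 0 = a)
    (h1 : f c = b) (hf : ∀ s ∈ Set.Icc 0 c, ∀ t ∈ Set.Icc 0 c,
      edist (f s) (f t) ≤ ENNReal.ofReal |s - t|) :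
    pathEDist a b ≤ ENNReal.ofReal c := by
  have hL : LipschitzWith c.toNNReal (fun t : unitInterval => f (t * c)) := by
    intro s t
    have hm : ∀ t : unitInterval, (t : ℝ) * c ∈ Set.Icc 0 c := fun t =>
      ⟨mul_nonneg t.2.1 hc, mul_le_of_le_one_left hc t.2.2⟩
    refine (hf _ (hm s) _ (hm t)).trans ?_
    rw [← sub_mul, abs_mul, abs_of_nonneg hc, mul_comm, ENNReal.ofReal_mul hc, edist_dist,
      Subtype.dist_eq, Real.dist_eq]
    rfl
  let γ : Path a b := ⟨⟨fun t : unitInterval => f (t * c), hL.continuous⟩, by simpa using h0,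
    by simpa using h1⟩
  refine (iInf_le _ γ).trans ?_
  have := (hL.lipschitzOnWith (s := Set.univ)).comp_eVariationOn_le
    (Set.mapsTo_univ (id : unitInterval → unitInterval) Set.univ)
  refine this.trans ((mul_le_mul_right eVariationOn_id_unitInterval_le _).trans ?_)
  rw [mul_one]
  rfl

/-- If each prescribed bound is realized by paths, the path metric of a chain metric is the chain
metric itself. -/
theorem pathEDist_eq_edist {M : Z → Z → ℝ≥0∞ → Prop}
    (hM : ∀ a b, edist a b = chainEDist M a b)
    (h : ∀ a b r, M a b r → pathEDist a b ≤ r ∧ pathEDist b a ≤ r) (a b : Z) :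
    pathEDist a b = edist a b := by
  refine le_antisymm ?_ (edist_le_pathEDist a b)
  rw [hM]
  refine le_iInf₂ fun l hl => ?_
  induction hl with
  | refl =>
    simpa using pathEDist_le_of_lipschitz (fun _ => a) le_rfl rfl rfl (fun _ _ _ _ => by simp)
  | forward _ hs ih => exact (pathEDist_triangle _ _ _).trans (add_le_add ih (h _ _ _ hs).1)
  | backward _ hs ih => exact (pathEDist_triangle _ _ _).trans (add_le_add ih (h _ _ _ hs).2)

end PathMetric

/-! ### Electrification -/

namespace Electrification

variable {X I : Type*} {Y : I → Set X}

@[elab_as_elim]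
theorem induction_on {P : Electrification Y → Prop} (u : Electrification Y)
    (h1 : ∀ x, P (ofBase Y x)) (h2 : ∀ i y t, P (cone Y i y t)) : P u := by
  induction u using Quot.ind with
  | mk u =>
    rcases u with x | ⟨i, y, t⟩
    · exact h1 x
    · exact h2 i y t

theorem cone_zero (i : I) (y : Y i) : cone Y i y 0 = ofBase Y y :=
  Quot.sound (ElectrificationGlue.base i y)

theorem cone_one (i : I) (y z : Y i) : cone Y i y 1 = cone Y i z 1 :=
  Quot.sound (ElectrificationGlue.apex i y z)

/-- The cone over `Y i`, which includes `Y i`. -/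
def Cone (Y : I → Set X) (i : I) : Set (Electrification Y) :=
  {u | Quot.lift (Sum.elim (fun x => x ∈ Y i)
    (fun v : Σ i, Y i × unitInterval => v.1 = i ∨ v.2.2 = 0 ∧ (v.2.1 : X) ∈ Y i))
    (by
      rintro _ _ (⟨j, y⟩ | ⟨j, y, z⟩)
      · simp only [Sum.elim_inr, Sum.elim_inl, true_and, eq_iff_iff, or_iff_right_iff_imp]
        rintro rfl
        exact y.2
      · simp) u}

open Classical in
/-- A point of `X` below a given point; an arbitrary point of `Y i` for the apex of the cone over
`Y i`. -/
noncomputable def base (Y : I → Set X) : Electrification Y → X :=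
  Quot.lift (Sum.elim id (fun v : Σ i, Y i × unitInterval =>
    if v.2.2 = 1 then ((Classical.choice ⟨v.2.1⟩ : Y v.1) : X) else v.2.1))
    (by rintro _ _ (⟨j, y⟩ | ⟨j, y, z⟩) <;> simp)

theorem cone_mem (i : I) (y : Y i) (t : unitInterval) : cone Y i y t ∈ Cone Y i := .inl rfl

variable [MetricSpace X]

theorem chainEDist_ofBase_le (u : Electrification Y) :
    ∃ x, chainEDist (Bound Y) u (ofBase Y x) ≤ 1 := by
  induction u using induction_on with
  | h1 x => exact ⟨x, ((chainPseudoEMetric (Bound Y)).edist_self _).le.trans zero_le_one⟩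
  | h2 i y t =>
    refine ⟨y, ?_⟩
    rw [← cone_zero]
    refine (chainEDist_le (Bound.segment i y t 0)).trans ?_
    rw [edist_dist, Subtype.dist_eq, Real.dist_eq]
    simpa using t.2.2.trans' (abs_of_nonneg t.2.1).le

theorem chainEDist_ne_top (u v : Electrification Y) : chainEDist (Bound Y) u v ≠ ⊤ := by
  obtain ⟨x, hx⟩ := chainEDist_ofBase_le u
  obtain ⟨y, hy⟩ := chainEDist_ofBase_le v
  have hx : chainEDist (Bound Y) u (ofBase Y x) ≠ ⊤ := ne_top_of_le_ne_top ENNReal.one_ne_top hx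
  have hy : chainEDist (Bound Y) (ofBase Y y) v ≠ ⊤ := by
    rw [show chainEDist (Bound Y) (ofBase Y y) v = chainEDist (Bound Y) v (ofBase Y y) from
      (chainPseudoEMetric (Bound Y)).edist_comm _ _]
    exact ne_top_of_le_ne_top ENNReal.one_ne_top hy
  have hxy : chainEDist (Bound Y) (ofBase Y x) (ofBase Y y) ≠ ⊤ :=
    ne_top_of_le_ne_top (edist_ne_top x y) (chainEDist_le (Bound.base x y))
  refine ne_top_of_le_ne_top (ENNReal.add_ne_top.mpr ⟨ENNReal.add_ne_top.mpr ⟨hx, hxy⟩, hy⟩)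
    (((chainPseudoEMetric (Bound Y)).edist_triangle u (ofBase Y y) v).trans
      (add_le_add ((chainPseudoEMetric (Bound Y)).edist_triangle u (ofBase Y x) _) le_rfl))

theorem isAttachment (Y : I → Set X) : IsAttachment Y (Bound Y) (ofBase Y) (base Y) (Cone Y) where
  base_ι _ := rfl
  ι_mem h := h
  mem_ι h := h
  base_mem {u i} := by
    induction u using induction_on with
    | h1 x => exact id
    | h2 j y t =>
      intro h
      change (if t = 1 then ((Classical.choice ⟨y⟩ : Y j) : X) else y) ∈ Y i
      rcases h with h | ⟨h, hy⟩
      · obtain rfl : j = i := h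
        split_ifs <;> exact Subtype.property _
      · rw [if_neg (by rw [show t = 0 from h]; exact zero_ne_one)]
        exact hy
  cover u := by
    induction u using induction_on with
    | h1 x => exact .inl rfl
    | h2 j y t => exact .inr ⟨j, cone_mem j y t⟩
  inter {u i j} := by
    induction u using induction_on with
    | h1 x => exact fun _ _ => .inr rfl
    | h2 k y t =>
      rintro (h | ⟨h, -⟩) (h' | ⟨h', -⟩)
      · exact .inl (h.symm.trans h')
      all_goals
        obtain rfl : t = 0 := by assumption
        rw [cone_zero]
        exact .inr rfl
  step := by
    rintro _ _ _ (⟨x, z⟩ | ⟨i, y, s, t⟩)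
    · exact .inl ⟨x, z, rfl, rfl, rfl⟩
    · exact .inr ⟨i, cone_mem i y s, cone_mem i y t⟩
  ι_step := Bound.base
  ne_top := chainEDist_ne_top

/-- As `X` is geodesic, the electric metric is the quotient metric. -/
theorem electricEDist_eq (hX : IsGeodesicSpace X) (u v : Electrification Y) :
    electricEDist Y u v = chainEDist (Bound Y) u v := by
  have hbase : ∀ x z : X, pathEDist (ofBase Y x) (ofBase Y z) ≤ edist x z := by
    intro x z
    obtain ⟨γ, h0, h1, hγ⟩ := hX x z
    rw [edist_dist]
    refine pathEDist_le_of_lipschitz (fun t => ofBase Y (γ t)) dist_nonneg (by rw [h0])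
      (by rw [h1]) fun s hs t ht => ?_
    rw [← hγ s hs t ht, ← edist_dist]
    exact chainEDist_le (Bound.base _ _)
  have hseg : ∀ (i : I) (y : Y i) (s t : unitInterval),
      pathEDist (cone Y i y s) (cone Y i y t) ≤ edist s t := by
    intro i y s t
    -- the segment from `s` to `t`, traversed in the direction `σ`
    obtain ⟨σ, hσ, hst⟩ : ∃ σ : ℝ, |σ| = 1 ∧ (s : ℝ) + σ * |(s : ℝ) - t| = t := by
      rcases le_total (s : ℝ) t with h | h
      · exact ⟨1, by simp, by rw [abs_of_nonpos (by linarith)]; ring⟩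
      · exact ⟨-1, by simp, by rw [abs_of_nonneg (by linarith)]; ring⟩
    rw [edist_dist, Subtype.dist_eq, Real.dist_eq]
    refine pathEDist_le_of_lipschitz
      (fun r => cone Y i y (Set.projIcc 0 1 zero_le_one (s + σ * r))) (abs_nonneg _) ?_ ?_
      fun a _ b _ => ?_
    · simp
    · rw [hst]
      simp
    · refine (chainEDist_le (Bound.segment i y _ _)).trans ?_
      rw [edist_dist]
      refine ENNReal.ofReal_le_ofReal ?_
      have := (LipschitzWith.projIcc (zero_le_one (α := ℝ))).dist_le_mul (s + σ * a) (s + σ * b)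
      simpa [Real.dist_eq, ← mul_sub, abs_mul, hσ] using this
  refine pathEDist_eq_edist (M := Bound Y) (fun _ _ => rfl) ?_ u v
  rintro _ _ _ (⟨x, z⟩ | ⟨i, y, s, t⟩)
  · exact ⟨hbase x z, edist_comm x z ▸ hbase z x⟩
  · exact ⟨hseg i y s t, edist_comm s t ▸ hseg i y t s⟩

theorem chainDist_le_two {i : I} {x z : X} (hx : x ∈ Y i) (hz : z ∈ Y i) :
    chainDist (Bound Y) (ofBase Y x) (ofBase Y z) ≤ 2 := by
  have hone : ∀ y : Y i, chainDist (Bound Y) (cone Y i y 0) (cone Y i y 1) ≤ 1 := by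
    intro y
    have := ENNReal.toReal_mono (edist_ne_top _ _) (chainEDist_le (Bound.segment i y 0 1))
    rw [edist_dist, ENNReal.toReal_ofReal dist_nonneg, Subtype.dist_eq] at this
    exact this.trans (by simp)
  have hρ := (isAttachment Y).isPseudoDist
  have h1 := hone ⟨x, hx⟩
  have h2 := hone ⟨z, hz⟩
  rw [cone_one i ⟨z, hz⟩ ⟨x, hx⟩] at h2
  rw [cone_zero] at h1 h2
  linarith [hρ.triangle (ofBase Y x) (cone Y i ⟨x, hx⟩ 1) (ofBase Y z),
    hρ.symm (ofBase Y z) (cone Y i ⟨x, hx⟩ 1)]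

/-- Points of `X` at small electric distance are close in `X`: paths which are shorter than `2`
do not visit the apices. -/
theorem min_dist_le (x z : X) :
    min (dist x z) 2 ≤ chainDist (Bound Y) (ofBase Y x) (ofBase Y z) := by
  -- a `1`-Lipschitz function which is `min (dist x z) 2` on `X` and `1` at the apices
  let f : Electrification Y → ℝ := Quot.lift (Sum.elim (fun z => min (dist x z) 2)
    (fun v => (1 - (v.2.2 : ℝ)) * min (dist x v.2.1) 2 + v.2.2))
    (by rintro _ _ (⟨j, y⟩ | ⟨j, y, z⟩) <;> simp)
  have hf : ∀ a b r, Bound Y a b r → ENNReal.ofReal |f a - f b| ≤ r := by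
    rintro _ _ _ (⟨a, b⟩ | ⟨i, y, s, t⟩)
    · rw [edist_dist]
      refine ENNReal.ofReal_le_ofReal ?_
      change |min (dist x a) 2 - min (dist x b) 2| ≤ _
      refine (abs_min_sub_min_le_max _ _ _ _).trans ?_
      rw [sub_self, abs_zero, max_eq_left (abs_nonneg _)]
      simpa [dist_comm x] using abs_dist_sub_le a b x
    · rw [edist_dist, Subtype.dist_eq, Real.dist_eq]
      refine ENNReal.ofReal_le_ofReal ?_
      change |((1 - (s : ℝ)) * min (dist x y) 2 + s) - ((1 - (t : ℝ)) * min (dist x y) 2 + t)| ≤ _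
      rw [show ((1 - (s : ℝ)) * min (dist x y) 2 + s) - ((1 - (t : ℝ)) * min (dist x y) 2 + t)
        = (1 - min (dist x y) 2) * (s - t) by ring, abs_mul]
      refine mul_le_of_le_one_left (abs_nonneg _) (abs_le.mpr ⟨?_, ?_⟩)
      · linarith [min_le_right (dist x y) 2]
      · linarith [le_min (dist_nonneg (x := x) (y := (y : X))) (zero_le_two (α := ℝ))]
  have := abs_sub_le_chainEDist f hf (ofBase Y x) (ofBase Y z) (chainEDist_ne_top _ _)
  change |min (dist x x) 2 - min (dist x z) 2| ≤ _ at this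
  rw [dist_self, min_eq_left zero_le_two, zero_sub, abs_neg] at this
  exact (le_abs_self _).trans this

end Electrification

/-- The four-point condition passes from a subset to its unit neighbourhood. -/
theorem FourPoint.of_range {X Z : Type*} {ρ : Z → Z → ℝ} (hρ : IsPseudoDist ρ) {ι : X → Z} {δ : ℝ}
    (h : FourPoint (fun x y => ρ (ι x) (ι y)) δ) (hι : ∀ u, ∃ x, ρ u (ι x) ≤ 1) :
    FourPoint ρ (δ + 8) := by
  intro u v u' v'
  have key : ∀ {u v x y}, ρ u (ι x) ≤ 1 → ρ v (ι y) ≤ 1 → |ρ u v - ρ (ι x) (ι y)| ≤ 2 := by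
    intro u v x y hu hv
    rw [abs_le]
    constructor <;> linarith [hρ.triangle u (ι x) v, hρ.triangle (ι x) (ι y) v, hρ.symm v (ι y),
      hρ.triangle (ι x) u (ι y), hρ.triangle u v (ι y), hρ.symm u (ι x)]
  obtain ⟨x, hx⟩ := hι u
  obtain ⟨y, hy⟩ := hι v
  obtain ⟨x', hx'⟩ := hι u'
  obtain ⟨y', hy'⟩ := hι v'
  have h1 := abs_le.mp (key hx hy)
  have h2 := abs_le.mp (key hx' hy')
  have h3 := abs_le.mp (key hx hx')
  have h4 := abs_le.mp (key hy hy')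
  have h5 := abs_le.mp (key hx hy')
  have h6 := abs_le.mp (key hy hx')
  have m1 := le_max_left (ρ u u' + ρ v v') (ρ u v' + ρ v u')
  have m2 := le_max_right (ρ u u' + ρ v v') (ρ u v' + ρ v u')
  rcases h.cases x y x' y' with h | h <;> linarith

/-- In the coned-off space, the geodesics of `X` are geodesics up to a bounded error. So of two
coarsely crossing pairs, the sum of the distances along the crossing sides is largest. -/
theorem Electrification.fourPoint {X I : Type*} [MetricSpace X] (Y : I → Set X)
    (hX : IsGeodesicSpace X) {δ C : ℝ} (hδ : 0 ≤ δ) (hd : FourPoint (dist : X → X → ℝ) δ)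
    (hC : 0 ≤ C) (hY : ∀ i, IsQuasiconvexSubset C (Y i)) :
    ∃ δ', FourPoint (chainDist (Bound Y)) δ' := by
  have hA := isAttachment Y
  have hρ := hA.isPseudoDist_ι
  have hG : IsGuess (fun x y => chainDist (Bound Y) (ofBase Y x) (ofBase Y y))
      (fun x y p => dist x p + dist p y = dist x y) (fun z z' => z = z' ∨ ∃ i, z ∈ Y i ∧ z' ∈ Y i)
      (2 * δ) (2 * (2 + C + δ)) := by
    refine ⟨fun {x y p} h => ?_, fun {x y p} h z => ?_, fun {x y p} hE h => ?_,
      fun {x y p} hxy h => ?_, hA.exists_step hX⟩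
    · rw [dist_comm y x, ← h, add_comm, dist_comm y, dist_comm p x]
    · obtain ⟨q, h1, h2⟩ := exists_between_of_triangle hδ hX hd h z
      exact ⟨q, h1, (hA.chainDist_ι_le p q).trans h2⟩
    · suffices chainDist (Bound Y) (ofBase Y x) (ofBase Y p) ≤ 2 + C + δ by
        linarith [hρ.triangle p x y, hρ.symm p x]
      rcases hE with rfl | ⟨i, hx, hy⟩
      · linarith [hA.chainDist_ι_le x p, dist_self x, dist_comm x p]
      · obtain ⟨q, hq, hpq⟩ := (hY i).exists_dist_le hX hd hx hy h
        linarith [chainDist_le_two hx hq, hρ.triangle x q p, hA.chainDist_ι_le q p, dist_comm p q]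
    · have h1 := min_dist_le (Y := Y) x y
      have h2 : dist x y ≤ 1 := by
        by_contra! h3
        exact absurd (h1.trans hxy) (not_le.mpr (lt_min h3 one_lt_two))
      linarith [hA.chainDist_ι_le x p, hA.chainDist_ι_le p y]
  obtain ⟨K, hK⟩ := hG.defect_le hρ
  have hK' : ∀ x y p, dist x p + dist p y ≤ dist x y + 2 * δ →
      chainDist (Bound Y) (ofBase Y x) (ofBase Y p) + chainDist (Bound Y) (ofBase Y p) (ofBase Y y)
        ≤ chainDist (Bound Y) (ofBase Y x) (ofBase Y y) + (K + 6 * δ) := by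
    intro x y p h
    obtain ⟨q, hq, hpq⟩ := exists_between_dist_le hδ hX hd (by linarith) h
    have := hA.chainDist_ι_le p q
    linarith [hK x y q hq, hρ.triangle x q p, hρ.triangle p q y, hρ.symm p q]
  refine ⟨_, FourPoint.of_range hA.isPseudoDist (ι := ofBase Y) (δ := 2 * (K + 6 * δ))
    (fun x y z w => ?_) fun u => ?_⟩
  · have m1 := le_max_left
      (chainDist (Bound Y) (ofBase Y x) (ofBase Y z) + chainDist (Bound Y) (ofBase Y y) (ofBase Y w))
      (chainDist (Bound Y) (ofBase Y x) (ofBase Y w) + chainDist (Bound Y) (ofBase Y y) (ofBase Y z))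
    have m2 := le_max_right
      (chainDist (Bound Y) (ofBase Y x) (ofBase Y z) + chainDist (Bound Y) (ofBase Y y) (ofBase Y w))
      (chainDist (Bound Y) (ofBase Y x) (ofBase Y w) + chainDist (Bound Y) (ofBase Y y) (ofBase Y z))
    obtain ⟨p, ⟨h1, h2⟩ | ⟨h1, h2⟩⟩ := exists_crossing hδ hX hd x y z w
    all_goals
      have h1 := hK' _ _ _ h1
      have h2 := hK' _ _ _ h2
      linarith [hρ.triangle x p y, hρ.triangle z p w, hρ.symm p y, hρ.symm z p]
  · obtain ⟨x, hx⟩ := chainEDist_ofBase_le u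
    exact ⟨x, ENNReal.toReal_mono ENNReal.one_ne_top hx⟩

/-! ### Projections to quasiconvex subsets -/

/-- Coarse projections `π i` onto the sets `Y i` of a hyperbolic space, with all errors bounded by
one constant `κ`: a geodesic to a point of `Y i` passes near the projection, a geodesic between two
points with distant projections passes near both of them, each `Y j` has a small projection to
every other `Y i`, and geodesics with endpoints in `Y i` stay near `Y i`. -/
structure IsProjectionSystem {X I : Type*} [MetricSpace X] (Y : I → Set X) (π : I → X → X)
    (κ : ℝ) : Prop where
  one_le : 1 ≤ κ
  mem : ∀ {i}, (Y i).Nonempty → ∀ x, π i x ∈ Y i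
  dist_le : ∀ {i q} x, q ∈ Y i → dist x (π i x) ≤ dist x q + 1
  proj : ∀ {i q} x, q ∈ Y i → dist x (π i x) + dist (π i x) q ≤ dist x q + κ
  contract : ∀ {i}, (Y i).Nonempty → ∀ x z, dist (π i x) (π i z) ≤ κ ∨
    dist x (π i x) + dist (π i x) (π i z) + dist (π i z) z ≤ dist x z + κ
  cobounded : ∀ {i j a b}, i ≠ j → (Y i).Nonempty → a ∈ Y j → b ∈ Y j →
    dist (π i a) (π i b) ≤ κ
  near : ∀ {i a b p}, a ∈ Y i → b ∈ Y i → dist a p + dist p b = dist a b →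
    ∃ q ∈ Y i, dist p q ≤ κ

/-- The points of geodesics from `x` to `z` which are not deep in any `Y i`: their projection to
each `Y i` is close to that of an endpoint. The factor `100` only has to be large compared with the
error constants of the projections. -/
def IsShallow {X I : Type*} [MetricSpace X] (Y : I → Set X) (π : I → X → X) (κ : ℝ)
    (x z p : X) : Prop :=
  dist x p + dist p z = dist x z ∧ ∀ i, (Y i).Nonempty →
    dist (π i p) (π i x) ≤ 100 * κ ∨ dist (π i p) (π i z) ≤ 100 * κ

section Projection

variable {X I : Type*} [MetricSpace X] {Y : I → Set X} {π : I → X → X} {δ κ : ℝ}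

theorem exists_isProjectionSystem (hX : IsGeodesicSpace X) (hδ : 0 ≤ δ)
    (hd : FourPoint (dist : X → X → ℝ) δ) {C : ℝ} (hC : 0 ≤ C)
    (hY : ∀ i, IsQuasiconvexSubset C (Y i)) (hco : IsMutuallyCobounded Y) :
    ∃ π κ, δ ≤ κ ∧ IsProjectionSystem Y π κ := by
  obtain ⟨D, π, hπ, hD⟩ := hco
  have hproj : ∀ i q x, q ∈ Y i →
      dist x (π i x) + dist (π i x) q ≤ dist x q + 2 * (2 * δ + C + 1) := by
    intro i q x hq
    obtain ⟨ha, hn⟩ := hπ i ⟨q, hq⟩ x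
    obtain ⟨m, h1, h2⟩ := hX.exists_dist_eq (π i x) q
      (r := (dist x (π i x) + dist (π i x) q - dist x q) / 2)
      (by linarith [dist_triangle x (π i x) q])
      (by linarith [dist_triangle x q (π i x), dist_comm q (π i x)])
    obtain ⟨y, hy, hmy⟩ := (hY i).exists_dist_le hX hd ha hq (p := m) (by linarith)
    have := hn y hy
    have := dist_triangle x m y
    have := dist_comm m (π i x)
    rcases hd.cases x m (π i x) q with h | h <;> linarith
  refine ⟨π, |D| + 10 * δ + 10 * C + 10, by linarith [abs_nonneg D], ?_⟩
  have hD0 := abs_nonneg D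
  refine ⟨by linarith, fun hi x => (hπ _ hi x).1, fun {i q} x hq => (hπ i ⟨q, hq⟩ x).2 q hq,
    fun {i q} x hq => (hproj i q x hq).trans (by linarith), fun {i} hi x z => ?_,
    fun hij hi ha hb => (hD _ _ hij hi _ ha _ hb).le.trans (by linarith [le_abs_self D]),
    fun {i a b p} ha hb hp => ?_⟩
  · by_contra! hcon
    have h1 := hproj i _ x (hπ i hi z).1
    have h2 := hproj i _ z (hπ i hi x).1
    have := dist_comm (π i x) z
    have := dist_comm (π i z) z
    have := dist_comm (π i z) (π i x)
    rcases hd.cases x (π i z) (π i x) z with h | h <;> linarith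
  · obtain ⟨q, hq, h⟩ := (hY i).exists_dist_le hX hd ha hb hp
    exact ⟨q, hq, by linarith⟩

namespace IsProjectionSystem

variable (hπ : IsProjectionSystem Y π κ)
include hπ

theorem dist_proj_self_le {i : I} {q : X} (hq : q ∈ Y i) : dist q (π i q) ≤ κ := by
  linarith [hπ.dist_le q hq, dist_self q, hπ.one_le]

theorem dist_proj_le {i : I} (hi : (Y i).Nonempty) (x z : X) :
    dist (π i x) (π i z) ≤ dist x z + κ := by
  have := dist_nonneg (x := x) (y := z)
  rcases hπ.contract hi x z with h | h
  · linarith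
  · linarith [dist_nonneg (x := x) (y := π i x), dist_nonneg (x := π i z) (y := z)]

/-- A point of a geodesic whose projection to `Y i` is far from those of both endpoints is close
to `Y i`. -/
theorem deep {i : I} (hi : (Y i).Nonempty) {x z p : X} (hp : dist x p + dist p z = dist x z)
    (h1 : κ < dist (π i p) (π i x)) (h2 : κ < dist (π i p) (π i z)) :
    dist p (π i p) ≤ κ ∧
      dist (π i p) (π i x) + dist (π i p) (π i z) ≤ dist (π i x) (π i z) + 2 * κ := by
  have e1 := dist_comm (π i p) (π i x)
  have e2 := dist_comm (π i p) p
  have g1 := (hπ.contract hi x p).resolve_left (by linarith)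
  have g2 := (hπ.contract hi p z).resolve_left (by linarith)
  have t1 := dist_triangle x (π i x) (π i p)
  have t2 := dist_triangle (π i p) (π i z) z
  have t3 := dist_triangle x (π i p) z
  have t4 := dist_triangle x (π i x) z
  have t5 := dist_triangle (π i x) (π i z) z
  have := dist_nonneg (x := p) (y := π i p)
  constructor <;> linarith

/-- If `x` and `z` have distant projections to `Y i`, a geodesic between them passes close to the
projection of `x` at a shallow point. Otherwise it would stay close to another `Y j` there, and
`Y i` would have a large projection to `Y j`. -/
theorem exists_isShallow (hX : IsGeodesicSpace X) (hδ : 0 ≤ δ)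
    (hd : FourPoint (dist : X → X → ℝ) δ) (hκ : δ ≤ κ) {i : I} (hi : (Y i).Nonempty) {x z : X}
    (hxz : 10 * κ < dist (π i x) (π i z)) :
    ∃ e, IsShallow Y π κ x z e ∧ dist e (π i x) ≤ 2 * κ := by
  have h1 := hπ.one_le
  have g := (hπ.contract hi x z).resolve_left (by linarith)
  obtain ⟨e, he, hpe⟩ := exists_between_dist_le hδ hX hd (x := x) (z := z) (p := π i x) (k := κ)
    (by linarith) (by linarith [dist_triangle (π i x) (π i z) z])
  rw [dist_comm] at hpe
  refine ⟨e, ⟨he, fun j hj => ?_⟩, by linarith⟩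
  by_contra! hcon
  obtain ⟨hc1, hc2⟩ := hcon
  have hmx := hπ.mem hi x
  have hmz := hπ.mem hi z
  by_cases hij : j = i
  · subst hij
    linarith [hπ.dist_le e hmx, dist_triangle (π j e) e (π j x), dist_comm (π j e) e]
  · obtain ⟨hd1, -⟩ := hπ.deep hj he (by linarith) (by linarith)
    have b1 := hπ.cobounded hij hj hmx hmz
    have b2 := hπ.dist_proj_le hj (π i x) e
    have e1 := dist_comm (π i x) e
    have t1 := dist_triangle (π j e) (π j (π i x)) (π j z)
    have t2 := dist_triangle (π j (π i x)) (π j (π i z)) (π j z)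
    have e2 := dist_comm (π j e) (π j (π i x))
    have g1 := (hπ.contract hj (π i z) z).resolve_left (by linarith)
    have t3 := dist_triangle (π i x) e z
    have t4 := dist_triangle e (π j e) z
    have t5 := dist_triangle (π j e) (π j z) z
    have g2 := hπ.proj z hmx
    have e3 := dist_comm z (π i z)
    have e4 := dist_comm z (π i x)
    have e5 := dist_comm (π i z) (π i x)
    have := dist_nonneg (x := π i z) (y := π j (π i z))
    linarith

omit hπ in
theorem _root_.IsShallow.symm {x z p : X} (h : IsShallow Y π κ x z p) : IsShallow Y π κ z x p :=
  ⟨by rw [dist_comm z x, ← h.1, add_comm, dist_comm z, dist_comm p x],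
    fun i hi => (h.2 i hi).symm⟩

/-- The thinness of triangles of shallow points, for a point `p` which is close to a point `p'` of a
given other side. If `p'` is deep in `Y i`, then `p` is close to the projection to `Y i` of a vertex,
where a side has shallow points. -/
theorem isShallow_thin_aux (hX : IsGeodesicSpace X) (hδ : 0 ≤ δ)
    (hd : FourPoint (dist : X → X → ℝ) δ) (hκ : δ ≤ κ) {x y z p p' : X}
    (hp : IsShallow Y π κ x y p) (hp' : dist x p' + dist p' z = dist x z)
    (hpp : dist p p' ≤ 2 * κ) :
    ∃ q, (IsShallow Y π κ x z q ∨ IsShallow Y π κ z y q) ∧ dist p q ≤ 1000 * κ := by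
  have h1 := hπ.one_le
  by_cases hs : IsShallow Y π κ x z p'
  · exact ⟨p', .inl hs, by linarith⟩
  obtain ⟨i, hi, hc1, hc2⟩ : ∃ i, (Y i).Nonempty ∧ 100 * κ < dist (π i p') (π i x) ∧
      100 * κ < dist (π i p') (π i z) := by
    by_contra! hcon
    exact hs ⟨hp', fun i hi => or_iff_not_imp_left.mpr fun h => hcon i hi (not_le.mp h)⟩
  obtain ⟨hd1, hd2⟩ := hπ.deep hi hp' (by linarith) (by linarith)
  have b1 := hπ.dist_proj_le hi p' p
  rw [dist_comm p' p] at b1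
  have t1 := dist_triangle p p' (π i p)
  have t2 := dist_triangle p' (π i p') (π i p)
  have e1 := dist_comm (π i z) (π i x)
  rcases hp.2 i hi with hpx | hpy
  · obtain ⟨e, he, hed⟩ := hπ.exists_isShallow hX hδ hd hκ hi (x := x) (z := z) (by linarith)
    refine ⟨e, .inl he, ?_⟩
    linarith [dist_triangle p (π i p) e, dist_triangle (π i p) (π i x) e, dist_comm e (π i x)]
  by_cases hyz : 10 * κ < dist (π i y) (π i z)
  · obtain ⟨e, he, hed⟩ := hπ.exists_isShallow hX hδ hd hκ hi (x := y) (z := z) hyz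
    refine ⟨e, .inr he.symm, ?_⟩
    linarith [dist_triangle p (π i p) e, dist_triangle (π i p) (π i y) e, dist_comm e (π i y)]
  · obtain ⟨e, he, hed⟩ := hπ.exists_isShallow hX hδ hd hκ hi (x := z) (z := x) (by linarith)
    refine ⟨e, .inl he.symm, ?_⟩
    linarith [dist_triangle p (π i p) e, dist_triangle (π i p) (π i y) e,
      dist_triangle (π i y) (π i z) e, dist_comm e (π i z)]

/-- Triangles of shallow points are thin. -/
theorem isShallow_thin (hX : IsGeodesicSpace X) (hδ : 0 ≤ δ)
    (hd : FourPoint (dist : X → X → ℝ) δ) (hκ : δ ≤ κ) {x y p : X}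
    (hp : IsShallow Y π κ x y p) (z : X) :
    ∃ q, (IsShallow Y π κ x z q ∨ IsShallow Y π κ z y q) ∧ dist p q ≤ 1000 * κ := by
  obtain ⟨p', h | h, hpp⟩ := exists_between_of_triangle hδ hX hd hp.1 z
  · exact hπ.isShallow_thin_aux hX hδ hd hκ hp h (by linarith)
  · obtain ⟨q, hq, hpq⟩ := hπ.isShallow_thin_aux hX hδ hd hκ hp.symm (z := z) (p' := p')
      (by rw [dist_comm y z, ← h, add_comm, dist_comm y, dist_comm p' z]) (by linarith)
    exact ⟨q, hq.symm.imp (·.symm) (·.symm), hpq⟩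

/-- Shallow points of geodesics with endpoints in `Y i` are close to one of the endpoints. -/
theorem isShallow_edge {i : I} {x y p : X} (hx : x ∈ Y i) (hy : y ∈ Y i)
    (hp : IsShallow Y π κ x y p) : dist x p ≤ 200 * κ ∨ dist y p ≤ 200 * κ := by
  have h1 := hπ.one_le
  obtain ⟨q, hq, hpq⟩ := hπ.near hx hy hp.1
  have a1 := hπ.dist_le p hq
  have a2 := hπ.dist_proj_self_le hx
  have a3 := hπ.dist_proj_self_le hy
  refine (hp.2 i ⟨x, hx⟩).imp (fun h => ?_) (fun h => ?_)
  · linarith [dist_triangle x (π i x) p, dist_triangle (π i x) (π i p) p, dist_comm p (π i p),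
      dist_comm (π i x) (π i p)]
  · linarith [dist_triangle y (π i y) p, dist_triangle (π i y) (π i p) p, dist_comm p (π i p),
      dist_comm (π i y) (π i p)]

end IsProjectionSystem

end Projection

/-! ### Distances on `X` that agree with geodesics at shallow points -/

/-- A pseudometric `ρ ≤ dist` on `X` for which shallow points of geodesics of `X` are on geodesics
of `ρ`, up to the error `K`. -/
structure IsShallowCompatible {X I : Type*} [MetricSpace X] (Y : I → Set X) (π : I → X → X)
    (κ : ℝ) (ρ : X → X → ℝ) (K : ℝ) : Prop where
  isPseudoDist : IsPseudoDist ρ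
  le_dist : ∀ x y, ρ x y ≤ dist x y
  defect : ∀ {x y p}, IsShallow Y π κ x y p → ρ x p + ρ p y ≤ ρ x y + K
  nonneg : 0 ≤ K

section Compatible

variable {X I : Type*} [MetricSpace X] {Y : I → Set X} {π : I → X → X} {δ κ K Λ : ℝ}
  {ρ : X → X → ℝ} (hπ : IsProjectionSystem Y π κ) (hρ : IsShallowCompatible Y π κ ρ K)
  (hX : IsGeodesicSpace X) (hδ : 0 ≤ δ) (hd : FourPoint (dist : X → X → ℝ) δ) (hκ : δ ≤ κ)

include hπ hρ hX hδ hd hκ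

/-- Paths between points with distant projections to `Y i` pass through both projections. -/
theorem IsShallowCompatible.add_add_le {i : I} (hi : (Y i).Nonempty) {x z : X}
    (hxz : 12 * κ < dist (π i x) (π i z)) :
    ρ x (π i x) + ρ (π i x) (π i z) + ρ (π i z) z ≤ ρ x z + (2 * K + 40 * κ) := by
  have h1 := hπ.one_le
  have hm := hρ.isPseudoDist
  have a1 := hπ.dist_proj_self_le (hπ.mem hi x)
  obtain ⟨e, he, hed⟩ := hπ.exists_isShallow hX hδ hd hκ hi (x := x) (z := z) (by linarith)
  obtain ⟨e', he', hed'⟩ := hπ.exists_isShallow hX hδ hd hκ hi (x := z) (z := π i x) (by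
    linarith [dist_triangle (π i x) (π i (π i x)) (π i z),
      dist_comm (π i (π i x)) (π i z)])
  have b1 := hρ.defect he
  have b2 := hρ.defect he'
  have c1 := hρ.le_dist e (π i x)
  have c2 := hρ.le_dist e' (π i z)
  linarith [hm.triangle x e (π i x), hm.triangle (π i x) e z, hm.symm e (π i x),
    hm.triangle z e' (π i z), hm.triangle (π i z) e' (π i x), hm.symm e' (π i z),
    hm.symm z (π i z), hm.symm z (π i x), hm.symm (π i z) (π i x)]

/-- Paths from a point of `Y i` pass through the projection to `Y i` of their endpoint. -/
theorem IsShallowCompatible.add_le {i : I} {c : X} (hc : c ∈ Y i) (x : X) :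
    ρ c (π i x) + ρ (π i x) x ≤ ρ c x + (2 * K + 40 * κ) := by
  have h1 := hπ.one_le
  have hm := hρ.isPseudoDist
  have hK := hρ.nonneg
  have a1 := hπ.dist_proj_self_le hc
  have c1 := hρ.le_dist c (π i c)
  by_cases h : 12 * κ < dist (π i c) (π i x)
  · linarith [hρ.add_add_le hπ hX hδ hd hκ ⟨c, hc⟩ h, hm.triangle c (π i c) (π i x)]
  · linarith [hρ.le_dist c (π i x), dist_triangle c (π i c) (π i x), hm.triangle (π i x) c x,
      hm.symm (π i x) c]

/-- The four-point condition in case `xz` and `yw` both pass through `Y i`, and `xz` does so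
deeply. If `yw` does so deeply as well, it reduces to the four-point condition in the horoball
over `Y i`. -/
theorem IsShallowCompatible.fourPoint_of_deep
    (hΛ : ∀ i, ∀ a ∈ Y i, ∀ b ∈ Y i, ∀ c ∈ Y i, ∀ d ∈ Y i,
      ρ a b + ρ c d ≤ max (ρ a c + ρ b d) (ρ a d + ρ b c) + Λ) (hΛ0 : 0 ≤ Λ)
    {i : I} {x y z w q : X} (hq : q ∈ Y i) (hxz : 12 * κ < dist (π i x) (π i z))
    (hqx : 50 * κ < dist q (π i x)) (hqz : 50 * κ < dist q (π i z))
    (hyw : dist y q + dist q w ≤ dist y w + 10 * κ) :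
    ρ x y + ρ z w ≤ max (ρ x z + ρ y w) (ρ x w + ρ y z) + (4 * K + 200 * κ + Λ) := by
  have h1 := hπ.one_le
  have hm := hρ.isPseudoDist
  have hK := hρ.nonneg
  have hi : (Y i).Nonempty := ⟨q, hq⟩
  have m1 := le_max_left (ρ x z + ρ y w) (ρ x w + ρ y z)
  have m2 := le_max_right (ρ x z + ρ y w) (ρ x w + ρ y z)
  have t1 := hm.triangle x (π i x) y
  have t2 := hm.triangle (π i x) (π i y) y
  have t3 := hm.triangle z (π i z) w
  have t4 := hm.triangle (π i z) (π i w) w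
  have s1 := hm.symm y (π i y)
  have s2 := hm.symm z (π i z)
  have s3 := hm.symm (π i z) (π i y)
  have s4 := hm.symm (π i w) (π i y)
  have s5 := hm.symm (π i z) (π i x)
  have s6 := dist_comm (π i z) (π i y)
  have f1 := hρ.add_add_le hπ hX hδ hd hκ hi hxz
  by_cases hfar : 12 * κ < dist (π i y) (π i w)
  -- If `y` and `w` have distant projections, `xz` and `yw` pass through `Y i`. If the projections
  -- of `x` and `w`, or of `y` and `z`, are close, they are exchanged at bounded cost.
  · have f2 := hρ.add_add_le hπ hX hδ hd hκ hi hfar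
    by_cases hxw : 12 * κ < dist (π i x) (π i w)
    · by_cases hyz : 12 * κ < dist (π i y) (π i z)
      · have f3 := hρ.add_add_le hπ hX hδ hd hκ hi hxw
        have f4 := hρ.add_add_le hπ hX hδ hd hκ hi hyz
        have := hΛ i _ (hπ.mem hi x) _ (hπ.mem hi y) _ (hπ.mem hi z) _ (hπ.mem hi w)
        rcases max_cases (ρ (π i x) (π i z) + ρ (π i y) (π i w))
          (ρ (π i x) (π i w) + ρ (π i y) (π i z)) with ⟨h5, _⟩ | ⟨h5, _⟩ <;> rw [h5] at this <;>
          linarith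
      · linarith [hρ.le_dist (π i y) (π i z), hm.triangle (π i x) (π i z) (π i y),
          hm.triangle (π i z) (π i y) (π i w)]
    · linarith [hρ.le_dist (π i x) (π i w), hm.triangle (π i x) (π i w) (π i y),
        hm.triangle (π i z) (π i x) (π i w)]
  -- Otherwise `y` and `w` project close to `q`, which is deep between `x` and `z`. Then `xw` and `yz`
  -- pass through `Y i` near `q`.
  · have g1 := hπ.proj y hq
    have g2 := hπ.proj w hq
    have e1 := dist_comm w q
    have e2 := dist_comm (π i w) w
    have e3 := dist_comm (π i y) q
    have e4 := dist_comm (π i w) q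
    have t5 := dist_triangle y (π i y) w
    have t6 := dist_triangle (π i y) (π i w) w
    have n1 := dist_nonneg (x := π i y) (y := q)
    have n2 := dist_nonneg (x := π i w) (y := q)
    have t7 := dist_triangle q (π i w) (π i x)
    have t8 := dist_triangle q (π i y) (π i z)
    have e5 := dist_comm (π i w) (π i x)
    have f3 := hρ.add_add_le hπ hX hδ hd hκ hi (x := x) (z := w) (by linarith)
    have f4 := hρ.add_add_le hπ hX hδ hd hκ hi (x := y) (z := z) (by linarith)
    linarith [hρ.le_dist (π i y) (π i w), hm.triangle (π i x) (π i w) (π i y),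
      hm.triangle (π i z) (π i y) (π i w)]

/-- The four-point condition in case `xz` and `yw` cross. -/
theorem IsShallowCompatible.fourPoint_of_crossing
    (hΛ : ∀ i, ∀ a ∈ Y i, ∀ b ∈ Y i, ∀ c ∈ Y i, ∀ d ∈ Y i,
      ρ a b + ρ c d ≤ max (ρ a c + ρ b d) (ρ a d + ρ b c) + Λ) (hΛ0 : 0 ≤ Λ)
    {x y z w p : X} (hxz : dist x p + dist p z ≤ dist x z + 2 * δ)
    (hyw : dist y p + dist p w ≤ dist y w + 2 * δ) :
    ρ x y + ρ z w ≤ max (ρ x z + ρ y w) (ρ x w + ρ y z) + (4 * K + 200 * κ + Λ) := by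
  have h1 := hπ.one_le
  have hm := hρ.isPseudoDist
  have hK := hρ.nonneg
  obtain ⟨p1, hp1, hd1⟩ := exists_between_dist_le hδ hX hd (by linarith) hxz
  obtain ⟨p2, hp2, hd2⟩ := exists_between_dist_le hδ hX hd (by linarith) hyw
  have key : ∀ {x y z w p1 : X}, dist x p1 + dist p1 z = dist x z → ¬ IsShallow Y π κ x z p1 →
      dist p p1 ≤ 3 * κ → dist y p + dist p w ≤ dist y w + 2 * δ →
      ρ x y + ρ z w ≤ max (ρ x z + ρ y w) (ρ x w + ρ y z) + (4 * K + 200 * κ + Λ) := by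
    intro x y z w p1 hp1 hs hd1 hyw
    obtain ⟨i, hi, hc1, hc2⟩ : ∃ i, (Y i).Nonempty ∧ 100 * κ < dist (π i p1) (π i x) ∧
        100 * κ < dist (π i p1) (π i z) := by
      by_contra! hcon
      exact hs ⟨hp1, fun i hi => or_iff_not_imp_left.mpr fun h => hcon i hi (not_le.mp h)⟩
    obtain ⟨g1, g2⟩ := hπ.deep hi hp1 (by linarith) (by linarith)
    refine hρ.fourPoint_of_deep hπ hX hδ hd hκ hΛ hΛ0 (hπ.mem hi p1) (by linarith) (by linarith)
      (by linarith) ?_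
    linarith [dist_triangle y p (π i p1), dist_triangle p p1 (π i p1),
      dist_triangle (π i p1) p w, dist_comm p (π i p1)]
  by_cases hs1 : IsShallow Y π κ x z p1
  swap
  · exact key hp1 hs1 (by linarith) hyw
  by_cases hs2 : IsShallow Y π κ y w p2
  swap
  · have := key hp2 hs2 (by linarith) hxz
    rwa [hm.symm y x, hm.symm w z, add_comm (ρ y w), add_comm (ρ y z)] at this
  have g1 := hρ.defect hs1
  have g2 := hρ.defect hs2
  have m1 := le_max_left (ρ x z + ρ y w) (ρ x w + ρ y z)
  have d1 := hρ.le_dist p1 p2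
  have t := dist_triangle p1 p p2
  rw [dist_comm p1 p] at t
  linarith [hm.triangle x p1 y, hm.triangle p1 p2 y, hm.triangle z p1 w, hm.triangle p1 p2 w,
    hm.symm p2 y, hm.symm z p1]

theorem IsShallowCompatible.fourPoint
    (hΛ : ∀ i, ∀ a ∈ Y i, ∀ b ∈ Y i, ∀ c ∈ Y i, ∀ d ∈ Y i,
      ρ a b + ρ c d ≤ max (ρ a c + ρ b d) (ρ a d + ρ b c) + Λ) (hΛ0 : 0 ≤ Λ) :
    FourPoint ρ (4 * K + 200 * κ + Λ) := by
  intro x y z w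
  obtain ⟨p, ⟨h1, h2⟩ | ⟨h1, h2⟩⟩ := exists_crossing hδ hX hd x y z w
  · exact hρ.fourPoint_of_crossing hπ hX hδ hd hκ hΛ hΛ0 h1 h2
  · have := hρ.fourPoint_of_crossing hπ hX hδ hd hκ hΛ hΛ0 h1 h2
    rwa [hρ.isPseudoDist.symm w z, max_comm] at this

end Compatible

/-! ### Distances in horoballs -/

/-- The four-point condition for (logarithms of) quasi-ultrametrics. -/
theorem fourPoint_of_quasiUltrametric {Z : Type*} {u : Z → Z → ℝ} (hs : ∀ x y, u x y = u y x)
    (hu : ∀ x y z, u x y ≤ max (u x z) (u z y) + 1) : FourPoint u 2 := by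
  have hu' : ∀ x y z, u x y ≤ u x z + 1 ∨ u x y ≤ u z y + 1 := fun x y z => by
    rw [← le_max_iff, max_add_add_right]
    exact hu x y z
  intro x y z w
  have m1 := le_max_left (u x z + u y w) (u x w + u y z)
  have m2 := le_max_right (u x z + u y w) (u x w + u y z)
  have s1 := hs z y
  have s2 := hs w y
  have s3 := hs z x
  rcases hu' x y z with h1 | h1 <;> rcases hu' x y w with h2 | h2 <;>
    rcases hu' z w x with h3 | h3 <;> rcases hu' z w y with h4 | h4 <;> linarith

/-- The horizontal variation of the distance in a horoball, at height `k`. The factor `1 / 4` makes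
this bound hold without a multiplicative error, so that it can be summed along chains. -/
theorem abs_two_mul_logb_sub_le {A d d' : ℝ} {k : ℕ} (hA : 2 ^ k ≤ A) (hd : 0 ≤ d)
    (hd' : 0 ≤ d') :
    |2 * Real.logb 2 (A + d / 4) - 2 * Real.logb 2 (A + d' / 4)| ≤ |d - d'| / 2 ^ k := by
  wlog h : d' ≤ d generalizing d d'
  · rw [abs_sub_comm, abs_sub_comm d]
    exact this hd' hd (not_le.mp h).le
  have hk : (0 : ℝ) < 2 ^ k := by positivity
  have h0 : 0 < A + d' / 4 := by linarith
  have h1 : 0 < A + d / 4 := by linarith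
  have hlog : (1 / 2 : ℝ) ≤ Real.log 2 := by linarith [Real.log_two_gt_d9]
  have hle : Real.logb 2 (A + d' / 4) ≤ Real.logb 2 (A + d / 4) :=
    Real.logb_le_logb_of_le one_lt_two h0 (by linarith)
  rw [abs_of_nonneg (by linarith), abs_of_nonneg (by linarith), ← mul_sub,
    ← Real.logb_div h1.ne' h0.ne', Real.logb]
  have h2 : Real.log ((A + d / 4) / (A + d' / 4)) ≤ (d - d') / 4 / 2 ^ k := by
    refine (Real.log_le_sub_one_of_pos (by positivity)).trans ?_
    rw [div_sub_one h0.ne', show A + d / 4 - (A + d' / 4) = (d - d') / 4 by ring]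
    exact div_le_div_of_nonneg_left (by linarith) hk (by linarith)
  rw [mul_div_assoc', div_le_iff₀ (by linarith)]
  have h3 : 0 ≤ (d - d') / 2 ^ k := by
    apply div_nonneg <;> linarith
  have h4 : (d - d') / 4 / 2 ^ k = (d - d') / 2 ^ k / 4 := by ring
  nlinarith

/-- The vertical variation of the distance in a horoball. -/
theorem abs_two_mul_logb_rpow_sub_le {A : ℝ} (hA : 0 < A) (s t : ℝ) :
    |(2 * Real.logb 2 (2 ^ s + A) - s) - (2 * Real.logb 2 (2 ^ t + A) - t)| ≤ |s - t| := by
  wlog h : t ≤ s generalizing s t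
  · rw [abs_sub_comm, abs_sub_comm s]
    exact this t s (not_le.mp h).le
  have h0 : (0 : ℝ) < 2 ^ t := by positivity
  have h1 : (2 : ℝ) ^ t ≤ 2 ^ s := Real.rpow_le_rpow_of_exponent_le one_le_two h
  have hle : Real.logb 2 (2 ^ t + A) ≤ Real.logb 2 (2 ^ s + A) :=
    Real.logb_le_logb_of_le one_lt_two (by linarith) (by linarith)
  have hle' : Real.logb 2 (2 ^ s + A) ≤ (s - t) + Real.logb 2 (2 ^ t + A) := by
    have h2 : (1 : ℝ) ≤ 2 ^ (s - t) := Real.one_le_rpow one_le_two (by linarith)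
    have h3 : (2 : ℝ) ^ (s - t) * 2 ^ t = 2 ^ s := by
      rw [← Real.rpow_add two_pos]
      ring_nf
    rw [← Real.logb_rpow two_pos (by norm_num : (2 : ℝ) ≠ 1) (x := s - t),
      ← Real.logb_mul (by linarith) (by linarith)]
    refine Real.logb_le_logb_of_le one_lt_two (by linarith) ?_
    nlinarith
  rw [abs_of_nonneg (by linarith : (0 : ℝ) ≤ s - t), abs_le]
  constructor <;> linarith

namespace Horoballification

variable {X I : Type*} {Y : I → Set X}

@[elab_as_elim]
theorem induction_on {P : Horoballification Y → Prop} (u : Horoballification Y)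
    (h1 : ∀ x, P (ofBase Y x)) (h2 : ∀ i y t, P (horoball Y i y t)) : P u := by
  induction u using Quot.ind with
  | mk u =>
    rcases u with x | ⟨i, y, t⟩
    · exact h1 x
    · exact h2 i y t

theorem horoball_one (i : I) (y : Y i) :
    horoball Y i y ⟨1, Set.self_mem_Ici⟩ = ofBase Y y :=
  Quot.sound (HoroballificationGlue.base i y)

/-- The horoball over `Y i`, which includes `Y i`. -/
def Horoball (Y : I → Set X) (i : I) : Set (Horoballification Y) :=
  {u | Quot.lift (Sum.elim (fun x => x ∈ Y i)
    (fun v : Σ i, Y i × Set.Ici (1 : ℝ) => v.1 = i ∨ (v.2.2 : ℝ) = 1 ∧ (v.2.1 : X) ∈ Y i))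
    (by
      rintro _ _ ⟨j, y⟩
      simp only [Sum.elim_inr, Sum.elim_inl, true_and, eq_iff_iff, or_iff_right_iff_imp]
      rintro rfl
      exact y.2) u}

/-- The point of `X` below a given point. -/
def base (Y : I → Set X) : Horoballification Y → X :=
  Quot.lift (Sum.elim id (fun v : Σ i, Y i × Set.Ici (1 : ℝ) => (v.2.1 : X)))
    (by rintro _ _ ⟨j, y⟩; rfl)

/-- The height in the horoballs; it is `1` on `X`. -/
def height (Y : I → Set X) : Horoballification Y → ℝ :=
  Quot.lift (Sum.elim (fun _ => 1) (fun v : Σ i, Y i × Set.Ici (1 : ℝ) => (v.2.2 : ℝ)))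
    (by rintro _ _ ⟨j, y⟩; rfl)

theorem horoball_mem (i : I) (y : Y i) (t : Set.Ici (1 : ℝ)) :
    horoball Y i y t ∈ Horoball Y i := .inl rfl

theorem exists_eq_horoball {u : Horoballification Y} {i : I} (hu : u ∈ Horoball Y i) :
    ∃ y t, u = horoball Y i y t := by
  induction u using induction_on with
  | h1 x => exact ⟨⟨x, hu⟩, _, (horoball_one i ⟨x, hu⟩).symm⟩
  | h2 j y t =>
    rcases hu with h | ⟨h, hy⟩
    · obtain rfl : j = i := h
      exact ⟨y, t, rfl⟩
    · obtain rfl : t = ⟨1, Set.self_mem_Ici⟩ := Subtype.ext h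
      exact ⟨⟨y, hy⟩, ⟨1, Set.self_mem_Ici⟩,
        (horoball_one j y).trans (horoball_one i (⟨y, hy⟩ : Y i)).symm⟩

variable [MetricSpace X]

theorem chainEDist_horoball_le (i : I) (y : Y i) (s t : Set.Ici (1 : ℝ)) :
    chainEDist (Bound Y) (horoball Y i y s) (horoball Y i y t) ≤ ENNReal.ofReal |(s : ℝ) - t| := by
  refine (chainEDist_le (Bound.vertical i y s t)).trans ?_
  rw [edist_dist, Subtype.dist_eq, Real.dist_eq]

theorem chainEDist_base_ne_top (u : Horoballification Y) :
    chainEDist (Bound Y) u (ofBase Y (base Y u)) ≠ ⊤ := by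
  induction u using induction_on with
  | h1 x =>
    rw [show base Y (ofBase Y x) = x from rfl,
      show chainEDist (Bound Y) _ _ = 0 from (chainPseudoEMetric (Bound Y)).edist_self _]
    exact ENNReal.zero_ne_top
  | h2 i y t =>
    rw [show base Y (horoball Y i y t) = y from rfl, ← horoball_one]
    exact ne_top_of_le_ne_top ENNReal.ofReal_ne_top (chainEDist_horoball_le i y _ _)

theorem chainEDist_ne_top (u v : Horoballification Y) : chainEDist (Bound Y) u v ≠ ⊤ := by
  have hx := chainEDist_base_ne_top u
  have hy : chainEDist (Bound Y) (ofBase Y (base Y v)) v ≠ ⊤ := by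
    rw [show chainEDist (Bound Y) (ofBase Y (base Y v)) v = chainEDist (Bound Y) v _ from
      (chainPseudoEMetric (Bound Y)).edist_comm _ _]
    exact chainEDist_base_ne_top v
  have hxy : chainEDist (Bound Y) (ofBase Y (base Y u)) (ofBase Y (base Y v)) ≠ ⊤ :=
    ne_top_of_le_ne_top (edist_ne_top _ _) (chainEDist_le (Bound.base _ _))
  refine ne_top_of_le_ne_top (ENNReal.add_ne_top.mpr ⟨ENNReal.add_ne_top.mpr ⟨hx, hxy⟩, hy⟩)
    (((chainPseudoEMetric (Bound Y)).edist_triangle u (ofBase Y (base Y v)) v).trans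
      (add_le_add ((chainPseudoEMetric (Bound Y)).edist_triangle u (ofBase Y (base Y u)) _) le_rfl))

theorem isAttachment (Y : I → Set X) :
    IsAttachment Y (Bound Y) (ofBase Y) (base Y) (Horoball Y) where
  base_ι _ := rfl
  ι_mem h := h
  mem_ι h := h
  base_mem {u i} h := by
    obtain ⟨y, t, rfl⟩ := exists_eq_horoball h
    exact y.2
  cover u := by
    induction u using induction_on with
    | h1 x => exact .inl rfl
    | h2 j y t => exact .inr ⟨j, horoball_mem j y t⟩
  inter {u i j} := by
    induction u using induction_on with
    | h1 x => exact fun _ _ => .inr rfl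
    | h2 k y t =>
      rintro (h | ⟨h, -⟩) (h' | ⟨h', -⟩)
      · exact .inl (h.symm.trans h')
      all_goals
        obtain rfl : t = ⟨1, Set.self_mem_Ici⟩ := Subtype.ext (by assumption)
        exact .inr (horoball_one k y)
  step := by
    rintro _ _ _ (⟨x, z⟩ | ⟨i, y, s, t⟩ | ⟨i, y, z, k, hk⟩)
    · exact .inl ⟨x, z, rfl, rfl, rfl⟩
    · exact .inr ⟨i, horoball_mem i y s, horoball_mem i y t⟩
    · exact .inr ⟨i, horoball_mem i y _, horoball_mem i z _⟩
  ι_step := Bound.base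
  ne_top := chainEDist_ne_top

/-- The logarithm of `2 ^ s + 2 ^ t + d / 4`, where `s` and `t` are the heights of two points and `d`
is the distance of their base points. Up to an additive constant it is the height at
which geodesics between the two points run horizontally. -/
noncomputable def level (u v : Horoballification Y) : ℝ :=
  Real.logb 2 (2 ^ height Y u + 2 ^ height Y v + dist (base Y u) (base Y v) / 4)

theorem level_comm (u v : Horoballification Y) : level u v = level v u := by
  unfold level
  rw [dist_comm, add_comm ((2 : ℝ) ^ height Y u)]

theorem level_le (u v w : Horoballification Y) : level u v ≤ max (level u w) (level w v) + 1 := by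
  have pos : ∀ u v : Horoballification Y,
      0 < 2 ^ height Y u + 2 ^ height Y v + dist (base Y u) (base Y v) / 4 := fun u v => by
    positivity
  have h2 : (1 : ℝ) = Real.logb 2 2 := (Real.logb_self_eq_one one_lt_two).symm
  have hw : (0 : ℝ) < 2 ^ height Y w := by positivity
  have t := dist_triangle (base Y u) (base Y w) (base Y v)
  rw [← max_add_add_right, le_max_iff, h2]
  unfold level
  rw [← Real.logb_mul (pos _ _).ne' two_ne_zero, ← Real.logb_mul (pos _ _).ne' two_ne_zero]
  rcases le_total (2 ^ height Y u + 2 ^ height Y w + dist (base Y u) (base Y w) / 4)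
    (2 ^ height Y w + 2 ^ height Y v + dist (base Y w) (base Y v) / 4) with h | h
  · exact .inr (Real.logb_le_logb_of_le one_lt_two (pos _ _) (by linarith))
  · exact .inl (Real.logb_le_logb_of_le one_lt_two (pos _ _) (by linarith))

/-- The distance is bounded below by the length of the path that goes straight up to the level
`level u v`, and down again. -/
theorem le_chainDist (u v : Horoballification Y) :
    2 * level u v - height Y u - height Y v - 2 ≤ chainDist (Bound Y) u v := by
  have hpos : (0 : ℝ) < 2 ^ height Y u := by positivity
  have hf : ∀ a b r, Bound Y a b r →
      ENNReal.ofReal |(2 * level u a - height Y a) - (2 * level u b - height Y b)| ≤ r := by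
    rintro _ _ _ (⟨a, b⟩ | ⟨i, y, s, t⟩ | ⟨i, y, z, k, hk⟩)
    · rw [edist_dist]
      refine ENNReal.ofReal_le_ofReal ?_
      change |(2 * Real.logb 2 (2 ^ height Y u + 2 ^ (1 : ℝ) + dist (base Y u) a / 4) - 1) -
        (2 * Real.logb 2 (2 ^ height Y u + 2 ^ (1 : ℝ) + dist (base Y u) b / 4) - 1)| ≤ _
      rw [sub_sub_sub_cancel_right]
      refine (abs_two_mul_logb_sub_le (k := 0) ?_ dist_nonneg dist_nonneg).trans ?_
      · rw [pow_zero, Real.rpow_one]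
        linarith
      · rw [pow_zero, div_one]
        simpa [dist_comm (base Y u)] using abs_dist_sub_le a b (base Y u)
    · rw [edist_dist, Subtype.dist_eq, Real.dist_eq]
      refine ENNReal.ofReal_le_ofReal ?_
      change |(2 * Real.logb 2 (2 ^ height Y u + 2 ^ (s : ℝ) + dist (base Y u) y / 4) - s) -
        (2 * Real.logb 2 (2 ^ height Y u + 2 ^ (t : ℝ) + dist (base Y u) y / 4) - t)| ≤ _
      simp only [add_comm ((2 : ℝ) ^ height Y u), add_assoc]
      exact abs_two_mul_logb_rpow_sub_le (by positivity) _ _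
    · rw [edist_dist, ← ENNReal.ofReal_ofNat, ← ENNReal.ofReal_pow zero_le_two,
        ← ENNReal.ofReal_div_of_pos (by positivity)]
      refine ENNReal.ofReal_le_ofReal ?_
      change |(2 * Real.logb 2 (2 ^ height Y u + 2 ^ (k : ℝ) + dist (base Y u) y / 4) - k) -
        (2 * Real.logb 2 (2 ^ height Y u + 2 ^ (k : ℝ) + dist (base Y u) z / 4) - k)| ≤ _
      rw [sub_sub_sub_cancel_right]
      refine (abs_two_mul_logb_sub_le (k := k) ?_ dist_nonneg dist_nonneg).trans ?_
      · rw [Real.rpow_natCast]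
        linarith
      · gcongr
        simpa [dist_comm (base Y u)] using abs_dist_sub_le (y : X) z (base Y u)
  have h := abs_sub_le_chainEDist _ hf u v (chainEDist_ne_top u v)
  have hself : level u u = height Y u + 1 := by
    unfold level
    rw [dist_self, zero_div, add_zero, ← two_mul, Real.logb_mul two_ne_zero hpos.ne',
      Real.logb_self_eq_one one_lt_two, Real.logb_rpow two_pos (by norm_num), add_comm]
  rw [hself, abs_sub_comm] at h
  change _ ≤ chainDist (Bound Y) u v at h
  linarith [le_abs_self (2 * level u v - height Y v - (2 * (height Y u + 1) - height Y u))]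

/-- Going up to the first integral height above the level `level u v`, along the horosphere, and down
again. -/
theorem chainDist_le {i : I} {u v : Horoballification Y} (hu : u ∈ Horoball Y i)
    (hv : v ∈ Horoball Y i) :
    chainDist (Bound Y) u v ≤ 2 * level u v - height Y u - height Y v + 6 := by
  obtain ⟨y, s, rfl⟩ := exists_eq_horoball hu
  obtain ⟨z, t, rfl⟩ := exists_eq_horoball hv
  have hρ := (isAttachment Y).isPseudoDist
  set L := level (horoball Y i y s) (horoball Y i z t) with hL
  change _ ≤ 2 * L - s - t + 6
  replace hL : L = Real.logb 2 (2 ^ (s : ℝ) + 2 ^ (t : ℝ) + dist (y : X) z / 4) := hL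
  have hs0 : (0 : ℝ) < 2 ^ (s : ℝ) := by positivity
  have ht0 : (0 : ℝ) < 2 ^ (t : ℝ) := by positivity
  have hd0 := dist_nonneg (x := (y : X)) (y := (z : X))
  have hs1 : (1 : ℝ) ≤ s := s.2
  have hsL : (s : ℝ) ≤ L := by
    rw [hL, Real.le_logb_iff_rpow_le one_lt_two (by linarith)]
    linarith
  have htL : (t : ℝ) ≤ L := by
    rw [hL, Real.le_logb_iff_rpow_le one_lt_two (by linarith)]
    linarith
  obtain ⟨k, hk1, hk2⟩ : ∃ k : ℕ, L ≤ k ∧ (k : ℝ) < L + 1 :=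
    ⟨⌈L⌉₊, Nat.le_ceil L, Nat.ceil_lt_add_one (by linarith)⟩
  have hk : 1 ≤ k := by
    have : (1 : ℝ) ≤ k := by linarith
    exact_mod_cast this
  have hdk : dist (y : X) z / 2 ^ k ≤ 4 := by
    rw [hL, Real.logb_le_iff_le_rpow one_lt_two (by linarith), Real.rpow_natCast] at hk1
    rw [div_le_iff₀ (by positivity)]
    linarith
  let κ : Set.Ici (1 : ℝ) := ⟨(k : ℝ), Set.mem_Ici.mpr (Nat.one_le_cast.mpr hk)⟩
  have h1 : chainDist (Bound Y) (horoball Y i y s) (horoball Y i y κ) ≤ k - s := by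
    refine (ENNReal.toReal_mono ENNReal.ofReal_ne_top (chainEDist_horoball_le i y _ _)).trans ?_
    rw [ENNReal.toReal_ofReal (abs_nonneg _), abs_sub_comm]
    exact (abs_of_nonneg (by change (0 : ℝ) ≤ k - s; linarith)).le
  have h2 : chainDist (Bound Y) (horoball Y i z κ) (horoball Y i z t) ≤ k - t := by
    refine (ENNReal.toReal_mono ENNReal.ofReal_ne_top (chainEDist_horoball_le i z _ _)).trans ?_
    rw [ENNReal.toReal_ofReal (abs_nonneg _)]
    exact (abs_of_nonneg (by change (0 : ℝ) ≤ k - t; linarith)).le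
  have h3 : chainDist (Bound Y) (horoball Y i y κ) (horoball Y i z κ) ≤ 4 := by
    have hb : chainEDist (Bound Y) (horoball Y i y κ) (horoball Y i z κ)
        ≤ ENNReal.ofReal (dist (y : X) z / 2 ^ k) := by
      refine (chainEDist_le (Bound.horizontal i y z k hk)).trans ?_
      rw [edist_dist, ENNReal.ofReal_div_of_pos (by positivity), ENNReal.ofReal_pow zero_le_two,
        ENNReal.ofReal_ofNat]
    refine (ENNReal.toReal_mono ENNReal.ofReal_ne_top hb).trans ?_
    rwa [ENNReal.toReal_ofReal (by positivity)]
  linarith [hρ.triangle (horoball Y i y s) (horoball Y i y κ) (horoball Y i z t),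
    hρ.triangle (horoball Y i y κ) (horoball Y i z κ) (horoball Y i z t)]

/-- Horoballs satisfy the four-point condition, with no assumption on `Y i`. -/
theorem fourPoint_horoball (i : I) {u v u' v' : Horoballification Y} (hu : u ∈ Horoball Y i)
    (hv : v ∈ Horoball Y i) (hu' : u' ∈ Horoball Y i) (hv' : v' ∈ Horoball Y i) :
    chainDist (Bound Y) u v + chainDist (Bound Y) u' v' ≤
      max (chainDist (Bound Y) u u' + chainDist (Bound Y) v v')
        (chainDist (Bound Y) u v' + chainDist (Bound Y) v u') + 20 := by
  have m1 := le_max_left (chainDist (Bound Y) u u' + chainDist (Bound Y) v v')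
    (chainDist (Bound Y) u v' + chainDist (Bound Y) v u')
  have m2 := le_max_right (chainDist (Bound Y) u u' + chainDist (Bound Y) v v')
    (chainDist (Bound Y) u v' + chainDist (Bound Y) v u')
  have a1 := chainDist_le hu hv
  have a2 := chainDist_le hu' hv'
  have a3 := le_chainDist u u'
  have a4 := le_chainDist v v'
  have a5 := le_chainDist u v'
  have a6 := le_chainDist v u'
  rcases (fourPoint_of_quasiUltrametric level_comm level_le).cases u v u' v' with h | h <;> linarith

/-- Points of `X` at small distance are close in `X`. -/
theorem dist_le_of_chainDist_le {x z : X}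
    (h : chainDist (Bound Y) (ofBase Y x) (ofBase Y z) ≤ 1) : dist x z ≤ 16 := by
  have h1 := le_chainDist (ofBase Y x) (ofBase Y z)
  have h2 : level (ofBase Y x) (ofBase Y z)
    = Real.logb 2 (2 ^ (1 : ℝ) + 2 ^ (1 : ℝ) + dist x z / 4) := rfl
  have h3 : height Y (ofBase Y x) = 1 := rfl
  have h4 : height Y (ofBase Y z) = 1 := rfl
  have h5 : Real.logb 2 (2 ^ (1 : ℝ) + 2 ^ (1 : ℝ) + dist x z / 4) ≤ 3 := by linarith
  rw [Real.logb_le_iff_le_rpow one_lt_two (by positivity), Real.rpow_one] at h5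
  norm_num at h5
  linarith

end Horoballification

/-! ### From `X` to the horoballs -/

section Extension

variable {X Z I : Type*} [MetricSpace X] {Y : I → Set X} {M : Z → Z → ℝ≥0∞ → Prop}
  {ι : X → Z} {base : Z → X} {H : I → Set Z} {π : I → X → X} {κ K : ℝ}

/-- An attachment in which paths to `Y i`, and paths between points of `X` with distant projections
to `Y i`, pass through these projections, and in which the pieces satisfy the four-point condition. -/
structure IsHyperbolicAttachment (Y : I → Set X) (M : Z → Z → ℝ≥0∞ → Prop) (ι : X → Z)
    (base : Z → X) (H : I → Set Z) (π : I → X → X) (κ K : ℝ) : Prop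
    extends IsAttachment Y M ι base H where
  isProj : IsProjectionSystem Y π κ
  add_add_le : ∀ {i x z}, (Y i).Nonempty → 12 * κ < dist (π i x) (π i z) →
    chainDist M (ι x) (ι (π i x)) + chainDist M (ι (π i x)) (ι (π i z)) +
      chainDist M (ι (π i z)) (ι z) ≤ chainDist M (ι x) (ι z) + K
  add_le : ∀ {i c} x, c ∈ Y i → chainDist M (ι c) (ι (π i x)) + chainDist M (ι (π i x)) (ι x) ≤
    chainDist M (ι c) (ι x) + K
  nonneg : 0 ≤ K
  fourPoint : ∀ {i u v u' v'}, u ∈ H i → v ∈ H i → u' ∈ H i → v' ∈ H i →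
    chainDist M u v + chainDist M u' v' ≤ max (chainDist M u u' + chainDist M v v')
      (chainDist M u v' + chainDist M v u') + K

namespace IsHyperbolicAttachment

variable (hA : IsHyperbolicAttachment Y M ι base H π κ K)
include hA

/-- A path from a point of `X` to a point `v` outside of a piece `H k` passes through a point of `X`
with almost the same projection to `Y k` as `v`. -/
theorem exists_exit_proj {k : I} (hk : (Y k).Nonempty) {v : Z} (hv : v ∉ H k) (x : X) :
    ∃ c, chainDist M (ι x) (ι c) + chainDist M (ι c) v ≤ chainDist M (ι x) v + 1 ∧
      dist (π k c) (π k (base v)) ≤ κ := by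
  have hρ := hA.isPseudoDist
  have h1 := hA.isProj.one_le
  rcases hA.cover v with h | ⟨j, hj⟩
  · refine ⟨base v, ?_, by rw [dist_self]; linarith⟩
    rw [← h]
    linarith [hρ.self v]
  · obtain ⟨c, hc, h⟩ := hA.exists_exit hj x
    refine ⟨c, ?_, hA.isProj.cobounded (fun h => hv (h ▸ hj)) hk hc (hA.base_mem hj)⟩
    linarith [hρ.symm v (ι c), hρ.symm (ι c) (ι x), hρ.symm v (ι x)]

/-- Paths from a piece `H k` to a point outside pass through the projection to `Y k`. -/
theorem add_le_of_mem {k : I} {u v : Z} (hu : u ∈ H k) (hv : v ∉ H k) :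
    chainDist M u (ι (π k (base v))) + chainDist M (ι (π k (base v))) v ≤
      chainDist M u v + (K + 2 + 4 * κ) := by
  have hρ := hA.isPseudoDist
  have h1 := hA.isProj.one_le
  obtain ⟨c, hc, g1⟩ := hA.exists_entry hu hv
  obtain ⟨c', g2, hc'⟩ := hA.exists_exit_proj ⟨c, hc⟩ hv c
  have g3 := hA.add_le c' hc
  have g4 := hA.chainDist_ι_le (π k c') (π k (base v))
  linarith [hρ.triangle u (ι c) (ι (π k (base v))),
    hρ.triangle (ι c) (ι (π k c')) (ι (π k (base v))),
    hρ.triangle (ι (π k (base v))) (ι (π k c')) v, hρ.triangle (ι (π k c')) (ι c') v,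
    hρ.symm (ι (π k c')) (ι (π k (base v)))]

/-- Paths between points outside of `H k` with distant projections to `Y k` pass through both. -/
theorem add_add_le_of_notMem {k : I} (hk : (Y k).Nonempty) {u v : Z} (hu : u ∉ H k)
    (hv : v ∉ H k) (huv : 14 * κ < dist (π k (base u)) (π k (base v))) :
    chainDist M u (ι (π k (base u))) +
      chainDist M (ι (π k (base u))) (ι (π k (base v))) + chainDist M (ι (π k (base v))) v ≤
        chainDist M u v + (K + 2 + 4 * κ) := by
  have hρ := hA.isPseudoDist
  have h1 := hA.isProj.one_le
  obtain ⟨c, g1, hc⟩ : ∃ c, chainDist M u (ι c) + chainDist M (ι c) v ≤ chainDist M u v + 1 ∧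
      dist (π k c) (π k (base u)) ≤ κ := by
    rcases hA.cover u with h | ⟨i, hi⟩
    · refine ⟨base u, ?_, by rw [dist_self]; linarith⟩
      rw [← h]
      linarith [hρ.self u]
    · have hik : k ≠ i := fun h => hu (h ▸ hi)
      have hvi : v ∉ H i := fun hvi => by
        linarith [hA.isProj.cobounded hik hk (hA.base_mem hi) (hA.base_mem hvi)]
      obtain ⟨c, hc, h⟩ := hA.exists_entry hi hvi
      exact ⟨c, h, hA.isProj.cobounded hik hk hc (hA.base_mem hi)⟩
  obtain ⟨c', g2, hc'⟩ := hA.exists_exit_proj hk hv c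
  have g3 := hA.add_add_le (x := c) (z := c') hk (by
    linarith [dist_triangle (π k (base u)) (π k c) (π k (base v)),
      dist_triangle (π k c) (π k c') (π k (base v)), dist_comm (π k c) (π k (base u))])
  have g4 := hA.chainDist_ι_le (π k c') (π k (base v))
  have g5 := hA.chainDist_ι_le (π k c) (π k (base u))
  linarith [hρ.triangle u (ι c) (ι (π k (base u))),
    hρ.triangle (ι c) (ι (π k c)) (ι (π k (base u))),
    hρ.triangle (ι (π k (base u))) (ι (π k c)) (ι (π k (base v))),
    hρ.triangle (ι (π k c)) (ι (π k c')) (ι (π k (base v))),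
    hρ.triangle (ι (π k (base v))) (ι (π k c')) v, hρ.triangle (ι (π k c')) (ι c') v,
    hρ.symm (ι (π k c)) (ι (π k (base u))), hρ.symm (ι (π k c')) (ι (π k (base v)))]

/-- A point `u` of a piece `H k` can be added to the four-point condition. If the other points
project close to each other in `H k`, then `u` can be replaced by their common projection, which
lies in `X`. Otherwise the condition reduces to that of the projections, or to a tripod. -/
theorem fourPoint_of_ι {y z w : Z} {Δ : ℝ} (hΔ : 0 ≤ Δ)
    (ho : ∀ o : X, chainDist M (ι o) y + chainDist M z w ≤
      max (chainDist M (ι o) z + chainDist M y w) (chainDist M (ι o) w + chainDist M y z) + Δ)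
    (u : Z) :
    chainDist M u y + chainDist M z w ≤
      max (chainDist M u z + chainDist M y w) (chainDist M u w + chainDist M y z) +
        (Δ + (3 * K + 10 + 100 * κ)) := by
  classical
  have hρ := hA.isPseudoDist
  have h1 := hA.isProj.one_le
  have hK := hA.nonneg
  rcases hA.cover u with h | ⟨k, hk⟩
  · have := ho (base u)
    rw [← h] at this
    linarith
  have hne : (Y k).Nonempty := ⟨_, hA.base_mem hk⟩
  -- the projection to `H k`, which is the identity on `H k`
  let P : Z → Z := fun v => if v ∈ H k then v else ι (π k (base v))
  have hPmem : ∀ v, P v ∈ H k := fun v => by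
    dsimp only [P]
    split_ifs with h
    · exact h
    · exact hA.mem_ι (hA.isProj.mem hne _)
  have hP1 : ∀ {u} v, u ∈ H k →
      chainDist M u (P v) + chainDist M (P v) v ≤ chainDist M u v + (K + 2 + 4 * κ) := by
    intro u v hu
    dsimp only [P]
    split_ifs with h
    · linarith [hρ.self v]
    · exact hA.add_le_of_mem hu h
  have hP2 : ∀ v v', chainDist M v (P v) + chainDist M (P v) (P v') + chainDist M (P v') v' ≤
      chainDist M v v' + (K + 2 + 4 * κ) ∨
        chainDist M (P v) (P v') ≤ 14 * κ ∧ ∃ o, P v = ι o := by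
    intro v v'
    by_cases h : v ∈ H k
    · have h3 : P v = v := if_pos h
      left
      rw [h3]
      linarith [hP1 v' h, hρ.self v]
    by_cases h' : v' ∈ H k
    · have h3 : P v' = v' := if_pos h'
      left
      rw [h3]
      linarith [hP1 v h', hρ.self v', hρ.symm v v', hρ.symm v' (P v), hρ.symm (P v) v]
    · have h3 : P v = ι (π k (base v)) := if_neg h
      have h4 : P v' = ι (π k (base v')) := if_neg h'
      rw [h3, h4]
      by_cases hd : 14 * κ < dist (π k (base v)) (π k (base v'))
      · exact .inl (hA.add_add_le_of_notMem hne h h' hd)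
      · exact .inr ⟨(hA.chainDist_ι_le _ _).trans (not_lt.mp hd), _, rfl⟩
  have m1 := le_max_left (chainDist M u z + chainDist M y w) (chainDist M u w + chainDist M y z)
  have m2 := le_max_right (chainDist M u z + chainDist M y w) (chainDist M u w + chainDist M y z)
  have a2 := hP1 z hk
  have a3 := hP1 w hk
  have t1 := hρ.triangle u (P y) y
  have t2 := hρ.triangle z (P z) w
  have t3 := hρ.triangle (P z) (P w) w
  have s1 := hρ.symm z (P z)
  have s2 := hρ.symm y (P y)
  have s3 := hρ.symm (P w) (P y)
  have s4 := hρ.symm (P z) (P y)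
  have t4 := hρ.triangle u (P w) (P y)
  have t5 := hρ.triangle u (P z) (P y)
  have t6 := hρ.triangle (P z) (P y) (P w)
  rcases hP2 y w with hyw | ⟨hyw, o, hPo⟩ <;> rcases hP2 y z with hyz | ⟨hyz, o, hPo⟩
  -- `y` far from both `z` and `w` in the projection: the condition for the projections
  · have := hA.fourPoint hk (hPmem y) (hPmem z) (hPmem w)
    rcases max_cases (chainDist M u (P z) + chainDist M (P y) (P w))
      (chainDist M u (P w) + chainDist M (P y) (P z)) with ⟨h5, _⟩ | ⟨h5, _⟩ <;>
      rw [h5] at this <;> linarith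
  -- `y` close to exactly one of `z` and `w`: a tripod
  · linarith
  · linarith
  -- all three projections are close to each other, and to a point `o` of `X`
  · have := ho o
    rw [← hPo] at this
    have b2 := hρ.triangle (P y) (P z) z
    have b3 := hρ.triangle (P y) (P w) w
    have b4 := hP1 y hk
    have b7 := hρ.triangle u (P y) (P z)
    have b8 := hρ.triangle u (P y) (P w)
    have n1 := hρ.nonneg (P y) (P z)
    rcases max_cases (chainDist M (P y) z + chainDist M y w)
      (chainDist M (P y) w + chainDist M y z) with ⟨h5, _⟩ | ⟨h5, _⟩ <;>
      rw [h5] at this <;> linarith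

/-- The four-point condition passes from `X` to the whole space. -/
theorem fourPoint_of_fourPoint_ι {Δ : ℝ} (hΔ : 0 ≤ Δ)
    (h : FourPoint (fun x y => chainDist M (ι x) (ι y)) Δ) :
    ∃ Δ', FourPoint (chainDist M) Δ' := by
  have hρ := hA.isPseudoDist
  have h1 := hA.isProj.one_le
  have hK := hA.nonneg
  let Q (Δ : ℝ) (u y z w : Z) : Prop := chainDist M u y + chainDist M z w ≤
    max (chainDist M u z + chainDist M y w) (chainDist M u w + chainDist M y z) + Δ
  -- The condition is invariant under the Klein four-group.
  have swap1 : ∀ {Δ u y z w}, Q Δ u y z w → Q Δ y u w z := by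
    intro Δ u y z w h
    dsimp only [Q] at h ⊢
    rwa [hρ.symm y u, hρ.symm w z, add_comm (chainDist M y w), add_comm (chainDist M y z)]
  have swap2 : ∀ {Δ u y z w}, Q Δ u y z w → Q Δ z w u y := by
    intro Δ u y z w h
    dsimp only [Q] at h ⊢
    rwa [add_comm, hρ.symm z u, hρ.symm w y, hρ.symm z y, hρ.symm w u,
      add_comm (chainDist M y z)]
  obtain ⟨R, hR0, hR⟩ : ∃ R, 0 ≤ R ∧ ∀ {Δ y z w}, 0 ≤ Δ → (∀ o : X, Q Δ (ι o) y z w) →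
      ∀ u, Q (Δ + R) u y z w :=
    ⟨3 * K + 10 + 100 * κ, by linarith, fun hΔ ho u => hA.fourPoint_of_ι hΔ ho u⟩
  have q1 : ∀ u (y z w : X), Q (Δ + R) u (ι y) (ι z) (ι w) := fun u y z w =>
    hR hΔ (fun o => h o y z w) u
  have q2 : ∀ u v (z w : X), Q (Δ + R + R) u v (ι z) (ι w) := fun u v z w =>
    swap1 (hR (by linarith) (fun o => swap1 (q1 u o z w)) v)
  have q3 : ∀ u v u' (w : X), Q (Δ + R + R + R) u v u' (ι w) := fun u v u' w =>
    swap2 (hR (by linarith) (fun o => swap2 (q2 u v o w)) u')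
  have q4 : ∀ u v u' v', Q (Δ + R + R + R + R) u v u' v' := fun u v u' v' =>
    swap1 (swap2 (hR (by linarith) (fun o => swap2 (swap1 (q3 u v u' o))) v'))
  exact ⟨_, q4⟩

end IsHyperbolicAttachment

end Extension

/-! ### The horoballification -/

theorem Horoballification.fourPoint {X I : Type*} [MetricSpace X] (Y : I → Set X)
    (hX : IsGeodesicSpace X) {δ C : ℝ} (hδ : 0 ≤ δ) (hd : FourPoint (dist : X → X → ℝ) δ)
    (hC : 0 ≤ C) (hY : ∀ i, IsQuasiconvexSubset C (Y i)) (hco : IsMutuallyCobounded Y) :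
    ∃ δ', FourPoint (chainDist (Bound Y)) δ' := by
  obtain ⟨π, κ, hκ, hπ⟩ := exists_isProjectionSystem hX hδ hd hC hY hco
  have h1 := hπ.one_le
  have hA := isAttachment Y
  have hρ := hA.isPseudoDist_ι
  have hG : IsGuess (fun x y => chainDist (Bound Y) (ofBase Y x) (ofBase Y y))
      (IsShallow Y π κ) (fun z z' => z = z' ∨ ∃ i, z ∈ Y i ∧ z' ∈ Y i)
      (1000 * κ) (400 * κ) := by
    refine ⟨IsShallow.symm, fun {x y p} h z => ?_, fun {x y p} hE h => ?_,
      fun {x y p} hxy h => ?_, hA.exists_step hX⟩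
    · obtain ⟨q, h1, h2⟩ := hπ.isShallow_thin hX hδ hd hκ h z
      exact ⟨q, h1, (hA.chainDist_ι_le p q).trans h2⟩
    · have a1 := hA.chainDist_ι_le x p
      have a2 := hA.chainDist_ι_le y p
      have a3 := hρ.triangle p x y
      have a4 := hρ.triangle x y p
      have a5 := hρ.symm p x
      have a6 := hρ.symm p y
      have : dist x p ≤ 200 * κ ∨ dist y p ≤ 200 * κ := by
        rcases hE with rfl | ⟨i, hx, hy⟩
        · have := h.1
          rw [dist_self, dist_comm p x] at this
          exact .inl (by linarith)
        · exact hπ.isShallow_edge hx hy h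
      rcases this with h | h <;> linarith
    · have h2 := dist_le_of_chainDist_le hxy
      linarith [hA.chainDist_ι_le x p, hA.chainDist_ι_le p y, h.1]
  obtain ⟨K, hK⟩ := hG.defect_le hρ
  have hS : IsShallowCompatible Y π κ (fun x y => chainDist (Bound Y) (ofBase Y x) (ofBase Y y))
      |K| :=
    ⟨hρ, hA.chainDist_ι_le, fun {x y p} h => (hK x y p h).trans (by linarith [le_abs_self K]),
      abs_nonneg K⟩
  have h4 := hS.fourPoint hπ hX hδ hd hκ (Λ := 20)
    (fun i a ha b hb c hc d hd =>
      fourPoint_horoball (Y := Y) i (u := ofBase Y a) (v := ofBase Y b) (u' := ofBase Y c)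
        (v' := ofBase Y d) ha hb hc hd) (by norm_num)
  have hK0 := abs_nonneg K
  have hHA : IsHyperbolicAttachment Y (Bound Y) (ofBase Y) (base Y) (Horoball Y) π κ
      (2 * |K| + 40 * κ + 20) :=
    { hA with
      isProj := hπ
      add_add_le := fun hi h => (hS.add_add_le hπ hX hδ hd hκ hi h).trans (by linarith)
      add_le := fun x hc => (hS.add_le hπ hX hδ hd hκ hc x).trans (by linarith)
      nonneg := by linarith
      fourPoint := fun hu hv hu' hv' =>
        (fourPoint_horoball _ hu hv hu' hv').trans (by linarith) }
  exact hHA.fourPoint_of_fourPoint_ι (by linarith) h4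

theorem proposition2 {X : Type*} [MetricSpace X] (hgeod : IsGeodesicSpace X)
    (hhyp : IsGromovHyperbolic (edist : X → X → ℝ≥0∞))
    {I : Type*} (Y : I → Set X) (C : ℝ) (hC : 0 < C)
    (hY : ∀ i, IsQuasiconvexSubset C (Y i)) :
    IsGromovHyperbolic (Electrification.electricEDist Y) ∧
      (IsMutuallyCobounded Y → IsGromovHyperbolic (Horoballification.horoballEDist Y)) := by
  obtain ⟨δ, hδ, hd⟩ := hhyp.fourPoint
  constructor
  · obtain ⟨δ', h⟩ := Electrification.fourPoint Y hgeod hδ hd hC.le hY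
    rw [show Electrification.electricEDist Y = chainEDist (Electrification.Bound Y) from
      funext₂ (Electrification.electricEDist_eq hgeod)]
    exact isGromovHyperbolic_of_fourPoint Electrification.chainEDist_ne_top
      (chainPseudoEMetric (Electrification.Bound Y)).edist_comm h
  · intro hco
    obtain ⟨δ', h⟩ := Horoballification.fourPoint Y hgeod hδ hd hC.le hY hco
    exact isGromovHyperbolic_of_fourPoint Horoballification.chainEDist_ne_top
      (chainPseudoEMetric (Horoballification.Bound Y)).edist_comm h
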